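/- Let $d\ge 4$, $d^*=d-1$ and $L>\tfrac12$. Let $X_z$ $(z\in\mathbb Z^d)$ and $Y_z$ $(z\in\mathbb Z^d\setminus\{0\})$ be random vectors on a probability space $(\Omega,\mathcal F,\mathbb P)$, all of them independent and uniformly distributed on $[-L,L]^d$. Put $\mathbb Z(\mathbf X)=(z+X_z)_{z\in\mathbb Z^d}$, $\mathbb Z_0(\mathbf Y)=(z+Y_z)_{z\in\mathbb Z^d\setminus\{0\}}$, $J(z)=z+[-L,L]^d$ and $\hat p=\left(1-\frac1{2L}\right)^2$. Let $|\cdot|$ be the $\ell^1$-norm on $\mathbb Z^d$. *Configurations.* $\mathcal M(\mathbb R^d)$ is the set of nonnegative integer valued (possibly infinite on unbounded sets) Radon measures on $\mathbb R^d$, with the $\sigma$-algebra $\mathcal B(\mathcal M(\mathbb R^d))$ generated by the maps $\xi\mapsto\xi(K)$, $K$ compact. $\Pi$ sends a locally finite family $(x_j)_j$ of points of $\mathbb R^d$ to $\sum_j\delta_{x_j}\in\mathcal M(\mathbb R^d)$ (and, by convention, any other family to the zero measure). *Open bonds and percolation.* For $z,w\in\mathbb Z^d$ with $|z-w|=1$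 and $w\ne0$, the bond $\langle z,w\rangle$ is open if $z+X_z\in J(z)\cap J(w)$ and $w+Y_w\in J(z)\cap J(w)$. Let $f(t,a)=(t-\sum_{k}a_k,a_1,\dots,a_{d^*})\in\mathbb Z^d$ for $t\in\mathbb Z_{\ge0}$, $a\in\mathbb Z_{\ge0}^{d^*}$. Let $|N_t|$ be the number of open oriented paths from the origin to level $t$, that is, of sequences $a^0=0,a^1,\dots,a^t$ in $\mathbb Z_{\ge0}^{d^*}$ such that, for each $l<t$, $a^{l+1}=a^l$ or $a^{l+1}=a^l+e_i$ for some standard basis vector $e_i$, and the bond $\langle f(l,a^l),f(l+1,a^{l+1})\rangle$ is open. Put $|\overline N_t|=|N_t|/(d\hat p)^t$. *Restricted measures.* Let $\Gamma_t$ be the set of sequences $\gamma=(z_0,\dots,z_t)$ of distinct points of $\mathbb Z^d$ with $z_0=0$. For $\gamma\in\Gamma_t$ let $\Omega_\gamma$ be the event that $|z_{k+1}-z_k|=1$ and $\langle z_k,z_{k+1}\rangle$ is open for every $k<t$, and that $z_t$ has nonnegative coordinates and $|z_t|=t$. Let $A_\gamma\subset(\mathbb R^d)^{\mathbb Z^d}$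 be the set of $x$ with $x_{z_k}\in J(z_k)\cap J(z_{k+1})$ for $k<t$ and $x_z\in J(z)$ for all other $z$. Let $B_\gamma\subset(\mathbb R^d)^{\mathbb Z^d\setminus\{0\}}$ be the set of $y$ with $y_{z_{k+1}}\in J(z_k)\cap J(z_{k+1})$ for $k<t$ and $y_z\in J(z)$ for all other $z\ne0$. For $A\in\mathcal B(\mathcal M(\mathbb R^d))$ put $$\mu_t(A)=\frac1{(d\hat p)^t}\sum_{\gamma\in\Gamma_t}\mathbb P\big(\{\Pi(\mathbb Z(\mathbf X))\in A\cap\Pi(A_\gamma)\}\cap\Omega_\gamma\big),$$ $$\mu_{0,t}(A)=\frac1{(d\hat p)^t}\sum_{\gamma\in\Gamma_t}\mathbb P\big(\{\Pi(\mathbb Z_0(\mathbf Y))\in A\cap\Pi(B_\gamma)\}\cap\Omega_\gamma\big).$$ **Proposition.** Suppose that, with positive probability, $|\overline N_t|$ converges as $t\to\infty$ to a finite limit $|\overline N_\infty|>0$. Then the limits $$\mu^{rest}=\lim_{t\to\infty}\mu_t,\qquad \mu^{rest}_0=\lim_{t\to\infty}\mu_{0,t}$$ exist as finite measures on $\mathcal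 B(\mathcal M(\mathbb R^d))$ in total variation, meaning $\sup_{A}|\mu_t(A)-\mu^{rest}(A)|\to0$ and $\sup_{A}|\mu_{0,t}(A)-\mu^{rest}_0(A)|\to0$ over $A\in\mathcal B(\mathcal M(\mathbb R^d))$, and $\mu^{rest}$ and $\mu^{rest}_0$ are mutually absolutely continuous. -/

import Mathlib

open MeasureTheory ProbabilityTheory Filter Topology
open scoped ENNReal

namespace PerturbedLattice

/-! ### Configurations -/

/-- Sums of Dirac masses take values in `ℕ ∪ {∞}`. -/
theorem sum_dirac_apply {d : ℕ} {ι : Type*} (x : ι → Fin d → ℝ) {A : Set (Fin d → ℝ)}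
    (hA : MeasurableSet A) :
    (Measure.sum fun j => Measure.dirac (x j)) A = (((x ⁻¹' A).encard : ℕ∞) : ℝ≥0∞) := by
  let _ : MeasurableSpace ι := ⊤
  have hm : ∀ s : Set ι, MeasurableSet s := fun _ => MeasurableSpace.measurableSet_top
  have h : (Measure.sum fun j => Measure.dirac (x j)) A = Measure.count (x ⁻¹' A) := by
    rw [Measure.sum_apply _ hA, Measure.count, Measure.sum_apply _ (hm _)]
    refine tsum_congr fun j => ?_
    rw [Measure.dirac_apply' _ hA, Measure.dirac_apply' _ (hm _)]
    rfl
  rw [h, Measure.count_apply (hm _)]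

/-- A nonnegative integer valued Radon measure on `ℝ^d`. -/
def IsConf {d : ℕ} (ξ : Measure (Fin d → ℝ)) : Prop :=
  (∀ K : Set (Fin d → ℝ), IsCompact K → ξ K < ∞) ∧
    ∀ A : Set (Fin d → ℝ), MeasurableSet A → ∃ n : ℕ∞, ξ A = (n : ℝ≥0∞)

/-- The configuration space `𝓜(ℝ^d)`. -/
def Conf (d : ℕ) : Type := {ξ : Measure (Fin d → ℝ) // IsConf ξ}

/-- The σ-algebra on `𝓜(ℝ^d)` generated by the maps `ξ ↦ ξ(K)`, `K` compact. -/
instance instMeasurableSpaceConf (d : ℕ) : MeasurableSpace (Conf d) :=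
  ⨆ (K : Set (Fin d → ℝ)) (_ : IsCompact K),
    MeasurableSpace.comap (fun ξ : Conf d => ξ.1 K) inferInstance

/-- The empty configuration. -/
def emptyConf (d : ℕ) : Conf d :=
  ⟨0, fun _ _ => by simp, fun _ _ => ⟨0, by simp⟩⟩

/-- The family `x` has finitely many (indices of) points in every compact set. -/
def LocallyFin {d : ℕ} {ι : Type*} (x : ι → Fin d → ℝ) : Prop :=
  ∀ K : Set (Fin d → ℝ), IsCompact K → (x ⁻¹' K).Finite

theorem isConf_sum_dirac {d : ℕ} {ι : Type*} {x : ι → Fin d → ℝ} (hx : LocallyFin x) :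
    IsConf (Measure.sum fun j => Measure.dirac (x j)) := by
  refine ⟨fun K hK => ?_, fun A hA => ⟨_, sum_dirac_apply x hA⟩⟩
  rw [sum_dirac_apply x hK.measurableSet]
  simpa using (hx K hK)

open Classical in
/-- The projection `Π` that forgets the labels: `(x_j)_j ↦ ∑_j δ_{x_j}`. A family with an
accumulation of points has no image in `𝓜(ℝ^d)`; it is sent to the empty configuration (for
perturbed lattices with bounded perturbations this never occurs). -/
noncomputable def proj {d : ℕ} {ι : Type*} (x : ι → Fin d → ℝ) : Conf d :=
  if hx : LocallyFin x then ⟨Measure.sum fun j => Measure.dirac (x j), isConf_sum_dirac hx⟩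
  else emptyConf d

/-! ### The perturbed lattices and open bonds -/

/-- A lattice point seen in `ℝ^d`. -/
def pt {d : ℕ} (z : Fin d → ℤ) : Fin d → ℝ := fun i => (z i : ℝ)

/-- `J(z) = z + [-L, L]^d`. -/
def J {d : ℕ} (L : ℝ) (z : Fin d → ℤ) : Set (Fin d → ℝ) :=
  Set.Icc (fun i => (z i : ℝ) - L) (fun i => (z i : ℝ) + L)

/-- The perturbed lattice `(z + X_z)_{z ∈ ℤ^d}`. -/
def latticeX {d : ℕ} {Ω : Type*} (X : (Fin d → ℤ) → Ω → Fin d → ℝ) (ω : Ω) :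
    (Fin d → ℤ) → Fin d → ℝ :=
  fun z => pt z + X z ω

/-- The perturbed lattice `(z + Y_z)_{z ∈ ℤ^d ∖ {0}}` with the origin left out. -/
def latticeY {d : ℕ} {Ω : Type*} (Y : {z : Fin d → ℤ // z ≠ 0} → Ω → Fin d → ℝ) (ω : Ω) :
    {z : Fin d → ℤ // z ≠ 0} → Fin d → ℝ :=
  fun z => pt z.1 + Y z ω

/-- The bond `⟨z, w⟩` with `|z - w| = 1` is open: both `z + X_z` and `w + Y_w` lie in
`J(z) ∩ J(w)`. -/
def BondOpen {d : ℕ} {Ω : Type*} (L : ℝ) (X : (Fin d → ℤ) → Ω → Fin d → ℝ)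
    (Y : {z : Fin d → ℤ // z ≠ 0} → Ω → Fin d → ℝ) (z w : Fin d → ℤ) (ω : Ω) : Prop :=
  ∑ i, |z i - w i| = 1 ∧ latticeX X ω z ∈ J L z ∩ J L w ∧
    ∃ hw : w ≠ 0, latticeY Y ω ⟨w, hw⟩ ∈ J L z ∩ J L w

/-- `p̂`, the probability that a given bond is open when `1/2 ≤ L`. -/
noncomputable def pHat (L : ℝ) : ℝ := (1 - 1 / (2 * L)) ^ 2

/-! ### Generalized oriented bond percolation -/

/-- The embedding of time-space into the lattice:
`(t, a_1, …, a_m) ↦ (t - ∑ a_k, a_1, …, a_m)`. -/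
def embed {m : ℕ} (t : ℤ) (a : Fin m → ℕ) : Fin (m + 1) → ℤ :=
  Fin.cons (t - ∑ k, (a k : ℤ)) (fun k => (a k : ℤ))

/-- `⟨(t-1, z), (t, w)⟩` is a bond: `w = z` or `w = z + e_i` for some `i`. -/
def IsBond {m : ℕ} (z w : Fin m → ℕ) : Prop :=
  w = z ∨ ∃ i : Fin m, w = z + Pi.single i 1

/-- The state of the bond `⟨(t-1, z), (t, w)⟩`: it is open if the corresponding bond of the
perturbed lattice is open. -/
def EtaHat {m : ℕ} {Ω : Type*} (L : ℝ) (X : (Fin (m + 1) → ℤ) → Ω → Fin (m + 1) → ℝ)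
    (Y : {z : Fin (m + 1) → ℤ // z ≠ 0} → Ω → Fin (m + 1) → ℝ)
    (t : ℕ) (z w : Fin m → ℕ) (ω : Ω) : Prop :=
  BondOpen L X Y (embed ((t : ℤ) - 1) z) (embed (t : ℤ) w) ω

/-- `|N_t|`, the number of open oriented paths `(l, z_l)`, `0 ≤ l ≤ t`, from `(0, 0)` to
level `t`. -/
noncomputable def numPaths {m : ℕ} {Ω : Type*} (L : ℝ)
    (X : (Fin (m + 1) → ℤ) → Ω → Fin (m + 1) → ℝ)
    (Y : {z : Fin (m + 1) → ℤ // z ≠ 0} → Ω → Fin (m + 1) → ℝ) (t : ℕ) (ω : Ω) : ℕ :=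
  Set.ncard {z : Fin (t + 1) → Fin m → ℕ | z 0 = 0 ∧ ∀ l : Fin t,
    IsBond (z l.castSucc) (z l.succ) ∧ EtaHat L X Y ((l : ℕ) + 1) (z l.castSucc) (z l.succ) ω}

/-- The normalized number of open oriented paths, `|N_t| / ((m + 1) p̂)^t`. -/
noncomputable def numPathsBar {m : ℕ} {Ω : Type*} (L : ℝ)
    (X : (Fin (m + 1) → ℤ) → Ω → Fin (m + 1) → ℝ)
    (Y : {z : Fin (m + 1) → ℤ // z ≠ 0} → Ω → Fin (m + 1) → ℝ) (t : ℕ) (ω : Ω) : ℝ :=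
  (numPaths L X Y t ω : ℝ) / (((m + 1 : ℕ) : ℝ) * pHat L) ^ t

/-! ### Paths in the lattice and the restricted measures -/

/-- `Γ_t`: sequences `(z_0, …, z_t)` of distinct lattice points with `z_0 = 0`. -/
def Gam (d t : ℕ) : Type :=
  {γ : Fin (t + 1) → Fin d → ℤ // γ 0 = 0 ∧ Function.Injective γ}

/-- `ℤ^d_t`: lattice points with nonnegative coordinates and `ℓ¹`-norm `t`. -/
def level (d t : ℕ) : Set (Fin d → ℤ) := {z | (∀ i, 0 ≤ z i) ∧ ∑ i, |z i| = (t : ℤ)}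

/-- `Ω_γ(t, X, Y)`: every bond along `γ` is open, and `γ` ends in `ℤ^d_t`. -/
def pathEvent {d t : ℕ} {Ω : Type*} (L : ℝ) (X : (Fin d → ℤ) → Ω → Fin d → ℝ)
    (Y : {z : Fin d → ℤ // z ≠ 0} → Ω → Fin d → ℝ) (γ : Gam d t) : Set Ω :=
  {ω | (∀ k : Fin t, BondOpen L X Y (γ.1 k.castSucc) (γ.1 k.succ) ω) ∧
    γ.1 (Fin.last t) ∈ level d t}

/-- `A_γ(t)`: the coordinate at `z_k`, `k < t`, lies in `J(z_k) ∩ J(z_{k+1})`; the coordinate at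
any other `z` lies in `J(z)`. -/
def setA {d t : ℕ} (L : ℝ) (γ : Gam d t) : Set ((Fin d → ℤ) → Fin d → ℝ) :=
  {x | (∀ k : Fin t, x (γ.1 k.castSucc) ∈ J L (γ.1 k.castSucc) ∩ J L (γ.1 k.succ)) ∧
    ∀ z, (∀ k : Fin t, z ≠ γ.1 k.castSucc) → x z ∈ J L z}

/-- `B_γ(t)`: the coordinate at `z_{k+1}`, `k < t`, lies in `J(z_k) ∩ J(z_{k+1})`; the coordinate
at any other `z ≠ 0` lies in `J(z)`. -/
def setB {d t : ℕ} (L : ℝ) (γ : Gam d t) : Set ({z : Fin d → ℤ // z ≠ 0} → Fin d → ℝ) :=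
  {y | (∀ z : {z : Fin d → ℤ // z ≠ 0}, ∀ k : Fin t, z.1 = γ.1 k.succ →
      y z ∈ J L (γ.1 k.castSucc) ∩ J L (γ.1 k.succ)) ∧
    ∀ z : {z : Fin d → ℤ // z ≠ 0}, (∀ k : Fin t, z.1 ≠ γ.1 k.succ) → y z ∈ J L z.1}

/-- The random set `Λ_γ`, equal to `Π(A_γ(t))` on `Ω_γ(t, X, Y)` and empty elsewhere. -/
def LamX {d t : ℕ} {Ω : Type*} (L : ℝ) (X : (Fin d → ℤ) → Ω → Fin d → ℝ)
    (Y : {z : Fin d → ℤ // z ≠ 0} → Ω → Fin d → ℝ) (γ : Gam d t) (ω : Ω) : Set (Conf d) :=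
  {ξ | ξ ∈ proj '' setA L γ ∧ ω ∈ pathEvent L X Y γ}

/-- The random set `Λ_γ` for the lattice without the origin, equal to `Π(B_γ(t))` on
`Ω_γ(t, X, Y)` and empty elsewhere. -/
def LamY {d t : ℕ} {Ω : Type*} (L : ℝ) (X : (Fin d → ℤ) → Ω → Fin d → ℝ)
    (Y : {z : Fin d → ℤ // z ≠ 0} → Ω → Fin d → ℝ) (γ : Gam d t) (ω : Ω) : Set (Conf d) :=
  {ξ | ξ ∈ proj '' setB L γ ∧ ω ∈ pathEvent L X Y γ}

/-- `μ_t(·) = (d p̂)^{-t} ∑_{γ ∈ Γ_t} P(Π(ℤ(X)) ∈ · ∩ Λ_γ)`. -/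
noncomputable def mu {d : ℕ} {Ω : Type*} [MeasurableSpace Ω] (P : Measure Ω) (L : ℝ)
    (X : (Fin d → ℤ) → Ω → Fin d → ℝ) (Y : {z : Fin d → ℤ // z ≠ 0} → Ω → Fin d → ℝ) (t : ℕ) :
    Measure (Conf d) :=
  ENNReal.ofReal (1 / ((d : ℝ) * pHat L) ^ t) • Measure.sum fun γ : Gam d t =>
    (P.restrict {ω | proj (latticeX X ω) ∈ LamX L X Y γ ω}).map fun ω => proj (latticeX X ω)

/-- `μ_{0,t}(·) = (d p̂)^{-t} ∑_{γ ∈ Γ_t} P(Π(ℤ_0(Y)) ∈ · ∩ Λ_γ)`. -/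
noncomputable def muZero {d : ℕ} {Ω : Type*} [MeasurableSpace Ω] (P : Measure Ω) (L : ℝ)
    (X : (Fin d → ℤ) → Ω → Fin d → ℝ) (Y : {z : Fin d → ℤ // z ≠ 0} → Ω → Fin d → ℝ) (t : ℕ) :
    Measure (Conf d) :=
  ENNReal.ofReal (1 / ((d : ℝ) * pHat L) ^ t) • Measure.sum fun γ : Gam d t =>
    (P.restrict {ω | proj (latticeY Y ω) ∈ LamY L X Y γ ω}).map fun ω => proj (latticeY Y ω)

/-- The total variation distance `sup_A |μ(A) - μ'(A)|` of two finite measures. -/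
noncomputable def tvDist {E : Type*} [MeasurableSpace E] (μ μ' : Measure E) : ℝ≥0∞ :=
  ⨆ (A : Set E) (_ : MeasurableSet A), ENNReal.ofReal |μ.real A - μ'.real A|

end PerturbedLattice

/-! Only oriented paths contribute to the restricted measures, since a path of unit steps reaching
level `t` in `t` steps must raise one coordinate by one each time (`eq_wordPath`). Paths therefore
become words `s : Fin t → Fin d`. Let `W_t` be the normalized number of open words (`weight`).
Almost surely every particle stays in its own cube, so membership in `Π(A_γ)` or `Π(B_γ)` is
automatic on the path event. Thus `mu` and `muZero` at time `t` are the images of the same measure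
`W_t dP` under the two maps `Π(ℤ(X))` and `Π(ℤ_0(Y))`.

Convergence. Let `W = liminf W_n` and `c = E W`. Cutting paths at level `t` and applying Fatou's
lemma bounds `W` below by the normalized sum, over open words of length `t`, of `W` for the
environment seen from their endpoints (`le_limWeight`). These environments are independent of the
first `t` levels and have the original law, so `∫_A W ≥ c ∫_A W_t` for every `A` in the σ-algebra of
those levels. Since `E W_t = 1`, the inequalities for `A` and `Aᶜ` add up to an equality, hence both
are equalities and `c W_t = E[W | F_t]`. The percolation hypothesis gives `c > 0`, and Lévy's upward
theorem gives `W_t → W / c` in `L¹`. Total variation is bounded by this `L¹` distance, so both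
sequences of measures converge.

Comparison. The two limits are in fact equal. On the event that a path `z_0, …, z_t` is open, the
particle `X` labelled `z_k` and the particle `Y` labelled `z_{k+1}` are both uniform on `J(z_k) ∩
J(z_{k+1})`. Relabelling along the path matches the two lattices in law, apart from the `X` particle
labelled `z_t`, which leaves any compact window as `t` grows (`IsModel.measure_isLocal`). The
measures thus eventually agree on each local event, and local events determine a finite measure. -/

namespace PerturbedLattice

/-! ### Oriented words -/

/-- The site reached after `k` steps of the oriented walk with steps `s`. -/
def pos {d t : ℕ} (s : Fin t → Fin d) (k : ℕ) : Fin d → ℕ :=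
  ∑ j : Fin t, if j.1 < k then Pi.single (s j) 1 else 0

theorem pos_zero {d t : ℕ} (s : Fin t → Fin d) : pos s 0 = 0 := by
  simp [pos]

theorem pos_succ {d t : ℕ} (s : Fin t → Fin d) (k : Fin t) :
    pos s (k + 1) = pos s k + Pi.single (s k) 1 := by
  have h : (Pi.single (s k) 1 : Fin d → ℕ) =
      ∑ j : Fin t, if j = k then Pi.single (s j) 1 else 0 := by
    simp
  rw [h, pos, pos, ← Finset.sum_add_distrib]
  refine Finset.sum_congr rfl fun j _ => ?_
  rcases lt_trichotomy j.1 k.1 with hj | hj | hj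
  · have : j ≠ k := fun h => by simp [h] at hj
    simp [hj, this, Nat.lt_succ_of_lt hj]
  · have : j = k := Fin.ext hj
    simp [this]
  · have : j ≠ k := fun h => by simp [h] at hj
    have h1 : ¬ j.1 < k.1 + 1 := by omega
    have h2 : ¬ j.1 < k.1 := by omega
    simp [this, h1, h2]

theorem sum_pos {d t : ℕ} (s : Fin t → Fin d) {k : ℕ} (hk : k ≤ t) :
    ∑ i, pos s k i = k := by
  induction k with
  | zero => simp [pos_zero]
  | succ k ih =>
    have h := pos_succ s ⟨k, hk⟩
    simp only at h
    rw [h]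
    simp [Finset.sum_add_distrib, ih (by omega)]

theorem pos_succ_ne_zero {d t : ℕ} (s : Fin t → Fin d) (k : Fin t) : pos s (k + 1) ≠ 0 := by
  intro h
  have := sum_pos s (k := k + 1) k.2
  simp [h] at this

theorem pos_injective {d t : ℕ} (s : Fin t → Fin d) {k l : ℕ} (hk : k ≤ t) (hl : l ≤ t)
    (h : pos s k = pos s l) : k = l := by
  rw [← sum_pos s hk, h, sum_pos s hl]

theorem pos_append_left {d t n : ℕ} (s : Fin t → Fin d) (u : Fin n → Fin d) {k : ℕ}
    (hk : k ≤ t) : pos (Fin.append s u) k = pos s k := by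
  simp only [pos, Fin.sum_univ_add, Fin.append_left, Fin.append_right, Fin.val_castAdd,
    Fin.val_natAdd]
  rw [add_eq_left]
  exact Finset.sum_eq_zero fun j _ => if_neg (by omega)

theorem pos_append_right {d t n : ℕ} (s : Fin t → Fin d) (u : Fin n → Fin d) (k : ℕ) :
    pos (Fin.append s u) (t + k) = pos s t + pos u k := by
  simp only [pos, Fin.sum_univ_add, Fin.append_left, Fin.append_right, Fin.val_castAdd,
    Fin.val_natAdd]
  congr 1
  · refine Finset.sum_congr rfl fun j _ => ?_
    rw [if_pos (by omega), if_pos j.2]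
  · refine Finset.sum_congr rfl fun j _ => ?_
    simp

theorem word_ext {d t : ℕ} {s u : Fin t → Fin d} (h : ∀ k ≤ t, pos s k = pos u k) : s = u := by
  funext k
  have h1 := h (k + 1) k.2
  rw [pos_succ, pos_succ, h k k.2.le, add_right_inj] at h1
  have h2 := congrFun h1 (s k)
  by_contra hne
  simp [hne] at h2

/-- The inclusion of `ℕ^d` into `ℤ^d`. -/
def toZ {d : ℕ} (a : Fin d → ℕ) : Fin d → ℤ := fun i => a i

theorem toZ_injective {d : ℕ} : Function.Injective (toZ (d := d)) := fun a b h => by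
  funext i
  exact Int.ofNat_inj.1 (congrFun h i)

theorem toZ_zero {d : ℕ} : toZ (0 : Fin d → ℕ) = 0 := by
  funext i
  simp [toZ]

theorem toZ_ne_zero {d : ℕ} {a : Fin d → ℕ} (ha : a ≠ 0) : toZ a ≠ 0 := fun h =>
  ha (toZ_injective (h.trans toZ_zero.symm))

theorem toZ_add_single {d : ℕ} (a : Fin d → ℕ) (i : Fin d) :
    toZ (a + Pi.single i 1) = toZ a + Pi.single i 1 := by
  funext j
  by_cases h : j = i
  · subst h; simp [toZ]
  · simp [toZ, h]

theorem toZ_pos_succ {d t : ℕ} (s : Fin t → Fin d) (k : Fin t) :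
    toZ (pos s (k + 1)) = toZ (pos s k) + Pi.single (s k) 1 := by
  rw [pos_succ, toZ_add_single]

/-- A lattice path from the origin whose steps are the standard basis vectors `s`. -/
theorem eq_toZ_pos {d t : ℕ} {g : Fin (t + 1) → Fin d → ℤ} (h0 : g 0 = 0) {s : Fin t → Fin d}
    (hs : ∀ k : Fin t, g k.succ = g k.castSucc + Pi.single (s k) 1) (k : Fin (t + 1)) :
    g k = toZ (pos s k) := by
  induction k using Fin.induction with
  | zero => simp [h0, pos_zero, toZ_zero]
  | succ k ih =>
    rw [hs, ih, Fin.val_succ, toZ_pos_succ]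
    rfl

/-! ### The environment seen along oriented paths -/

/-- Labels of the environment variables in the positive orthant. -/
abbrev Idx (d : ℕ) : Type := (Fin d → ℕ) ⊕ {b : Fin d → ℕ // b ≠ 0}

/-- Displacements from a site keeping the particle in the cube of the next site in
direction `i`. -/
def slabOut {d : ℕ} (L : ℝ) (i : Fin d) : Set (Fin d → ℝ) := J L 0 ∩ J L (Pi.single i 1)

/-- Displacements from a site keeping the particle in the cube of the previous site in
direction `i`. -/
def slabIn {d : ℕ} (L : ℝ) (i : Fin d) : Set (Fin d → ℝ) := J L 0 ∩ J L (-Pi.single i 1)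

theorem measurableSet_J {d : ℕ} (L : ℝ) (z : Fin d → ℤ) : MeasurableSet (J L z) :=
  measurableSet_Icc

theorem measurableSet_slabOut {d : ℕ} (L : ℝ) (i : Fin d) : MeasurableSet (slabOut L i) :=
  (measurableSet_J _ _).inter (measurableSet_J _ _)

theorem measurableSet_slabIn {d : ℕ} (L : ℝ) (i : Fin d) : MeasurableSet (slabIn L i) :=
  (measurableSet_J _ _).inter (measurableSet_J _ _)

/-- Every bond along the oriented path with steps `s` is open in the environment `e`. -/
def EnvOpen {d t : ℕ} (L : ℝ) (s : Fin t → Fin d) (e : Idx d → Fin d → ℝ) : Prop :=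
  ∀ k : Fin t, e (Sum.inl (pos s k)) ∈ slabOut L (s k) ∧
    e (Sum.inr ⟨pos s (k + 1), pos_succ_ne_zero s k⟩) ∈ slabIn L (s k)

/-- Translation of labels. -/
def shiftIdx {d : ℕ} (x : Fin d → ℕ) : Idx d → Idx d :=
  Sum.map (x + ·) fun b => ⟨x + b.1, fun h => b.2 (by simp_all)⟩

theorem shiftIdx_injective {d : ℕ} (x : Fin d → ℕ) : Function.Injective (shiftIdx x) := by
  refine Sum.map_injective.2 ⟨fun a b h => by simpa using h, fun a b h => ?_⟩
  have := congrArg Subtype.val h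
  exact Subtype.ext (by simpa using this)

/-- The Markov-type cut of a path at level `t`: its second part is a path from the origin in the
environment seen from the endpoint of the first. -/
theorem envOpen_append {d t n : ℕ} (L : ℝ) (s : Fin t → Fin d) (u : Fin n → Fin d)
    (e : Idx d → Fin d → ℝ) :
    EnvOpen L (Fin.append s u) e ↔ EnvOpen L s e ∧ EnvOpen L u (e ∘ shiftIdx (pos s t)) := by
  constructor
  · intro h
    refine ⟨fun k => ?_, fun k => ?_⟩
    · have := h (Fin.castAdd n k)
      simpa only [Fin.append_left, Fin.val_castAdd, pos_append_left s u k.2.le,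
        pos_append_left s u (Nat.succ_le_of_lt k.2)] using this
    · have := h (Fin.natAdd t k)
      simpa only [Fin.append_right, Fin.val_natAdd, pos_append_right, add_assoc,
        Function.comp_apply, shiftIdx, Sum.map_inl, Sum.map_inr] using this
  · rintro ⟨h1, h2⟩ k
    refine Fin.addCases (fun k => ?_) (fun k => ?_) k
    · simpa only [Fin.append_left, Fin.val_castAdd, pos_append_left s u k.2.le,
        pos_append_left s u (Nat.succ_le_of_lt k.2)] using h1 k
    · simpa only [Fin.append_right, Fin.val_natAdd, pos_append_right, add_assoc,
        Function.comp_apply, shiftIdx, Sum.map_inl, Sum.map_inr] using h2 k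

theorem measurableSet_envOpen {d t : ℕ} (L : ℝ) (s : Fin t → Fin d) :
    MeasurableSet {e | EnvOpen L s e} := by
  refine MeasurableSet.congr (MeasurableSet.iInter fun k : Fin t =>
    (((measurable_pi_apply (Sum.inl (pos s k)) :
      Measurable fun e : Idx d → Fin d → ℝ => e _) (measurableSet_slabOut L (s k))).inter
    ((measurable_pi_apply (Sum.inr ⟨pos s (k + 1), pos_succ_ne_zero s k⟩) :
      Measurable fun e : Idx d → Fin d → ℝ => e _) (measurableSet_slabIn L (s k))))) ?_
  ext e
  simp [EnvOpen]

/-- The inverse of the expected number of open oriented paths of length `t`. -/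
noncomputable def norming (d : ℕ) (L : ℝ) (t : ℕ) : ℝ≥0∞ :=
  ENNReal.ofReal (1 / ((d : ℝ) * pHat L) ^ t)

theorem pHat_nonneg (L : ℝ) : 0 ≤ pHat L := sq_nonneg _

theorem norming_add (d : ℕ) (L : ℝ) (t n : ℕ) :
    norming d L (t + n) = norming d L t * norming d L n := by
  have : 0 ≤ (d : ℝ) * pHat L := mul_nonneg d.cast_nonneg (pHat_nonneg L)
  rw [norming, norming, norming, ← ENNReal.ofReal_mul (by positivity), pow_add]
  congr 1
  ring

/-- The normalized number of open oriented paths of length `t`. -/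
noncomputable def weight {d : ℕ} (L : ℝ) (t : ℕ) (e : Idx d → Fin d → ℝ) : ℝ≥0∞ :=
  norming d L t * ∑ s : Fin t → Fin d, {e | EnvOpen L s e}.indicator 1 e

theorem measurable_weight {d : ℕ} (L : ℝ) (t : ℕ) : Measurable (weight (d := d) L t) :=
  (Finset.measurable_fun_sum _ fun s _ =>
    measurable_one.indicator (measurableSet_envOpen L s)).const_mul _

theorem weight_ne_top {d : ℕ} (L : ℝ) (t : ℕ) (e : Idx d → Fin d → ℝ) : weight L t e ≠ ∞ := by
  refine ENNReal.mul_ne_top (by simp [norming]) (ENNReal.sum_ne_top.2 fun s _ => ?_)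
  by_cases h : EnvOpen L s e <;> simp [h]

theorem weight_add {d : ℕ} (L : ℝ) (t n : ℕ) (e : Idx d → Fin d → ℝ) :
    weight L (t + n) e = norming d L t * ∑ s : Fin t → Fin d,
      {e | EnvOpen L s e}.indicator 1 e * weight L n (e ∘ shiftIdx (pos s t)) := by
  rw [weight, norming_add, mul_assoc, Finset.mul_sum,
    ← (Fin.appendEquiv t n).sum_comp, Fintype.sum_prod_type]
  congr 1
  refine Finset.sum_congr rfl fun s _ => ?_
  rw [weight, mul_left_comm, Finset.mul_sum, Finset.mul_sum]
  refine Finset.sum_congr rfl fun u _ => ?_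
  congr 1
  have := envOpen_append L s u e
  by_cases h1 : EnvOpen L s e <;> by_cases h2 : EnvOpen L u (e ∘ shiftIdx (pos s t)) <;>
    simp_all [Fin.appendEquiv]

/-- The lower limit of the normalized numbers of open oriented paths. -/
noncomputable def limWeight {d : ℕ} (L : ℝ) (e : Idx d → Fin d → ℝ) : ℝ≥0∞ :=
  liminf (fun n => weight L n e) atTop

theorem measurable_limWeight {d : ℕ} (L : ℝ) : Measurable (limWeight (d := d) L) :=
  Measurable.liminf fun n => measurable_weight L n

/-- Fatou's lemma for counting measure. -/
theorem sum_liminf_le {ι : Type*} [Fintype ι] (f : ι → ℕ → ℝ≥0∞) :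
    ∑ i, liminf (f i) atTop ≤ liminf (fun n => ∑ i, f i n) atTop := by
  let _ : MeasurableSpace ι := ⊤
  have := lintegral_liminf_le (μ := (Measure.count : Measure ι)) (f := fun n i => f i n)
    (u := atTop) fun n => measurable_from_top
  simpa [lintegral_fintype] using this

/-- The decomposition `weight_add` is exact for every `n`. Letting `n → ∞` inside a finite sum of
lower limits costs an inequality, which `IsEnv.setLIntegral_limWeight` later shows to be an equality
almost surely. -/
theorem le_limWeight {d : ℕ} (L : ℝ) (t : ℕ) (e : Idx d → Fin d → ℝ) :
    norming d L t * ∑ s : Fin t → Fin d,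
      {e | EnvOpen L s e}.indicator 1 e * limWeight L (e ∘ shiftIdx (pos s t)) ≤
    limWeight L e := by
  have h : limWeight L e = liminf (fun n => weight L (t + n) e) atTop := by
    rw [limWeight, ← liminf_nat_add _ t]
    simp only [add_comm]
  simp only [h, weight_add]
  rw [ENNReal.liminf_const_mul_of_ne_top (by simp [norming])]
  refine mul_le_mul_right (le_trans (Finset.sum_le_sum fun s _ => ?_) (sum_liminf_le _)) _
  rw [ENNReal.liminf_const_mul_of_ne_top]
  · rfl
  · by_cases h1 : EnvOpen L s e <;> simp [h1]

/-! ### Independent families -/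

theorem measure_forall_mem {Ω ι κ E : Type*} [MeasurableSpace Ω] [MeasurableSpace E]
    {P : Measure Ω} {Z : ι → Ω → E} (hZ : iIndepFun Z P) [Fintype κ] {j : κ → ι}
    (hj : Function.Injective j) {C : κ → Set E} (hC : ∀ k, MeasurableSet (C k)) :
    P {ω | ∀ k, Z (j k) ω ∈ C k} = ∏ k, P (Z (j k) ⁻¹' C k) := by
  have := (hZ.precomp hj).measure_inter_preimage_eq_mul Finset.univ (sets := C) fun k _ => hC k
  rw [← this]
  congr 1
  ext ω
  simp

/-- Any injective selection from an i.i.d. family has the same infinite product law. This is the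
translation invariance of the environment. -/
theorem lintegral_comp_injective {Ω ι κ E : Type*} [MeasurableSpace Ω] [MeasurableSpace E]
    {P : Measure Ω} [IsProbabilityMeasure P] {Z : ι → Ω → E} (hZ : iIndepFun Z P)
    (hm : ∀ i, Measurable (Z i)) {ν : Measure E} (hν : ∀ i, P.map (Z i) = ν)
    {σ τ : κ → ι} (hσ : Function.Injective σ) (hτ : Function.Injective τ)
    {f : (κ → E) → ℝ≥0∞} (hf : Measurable f) :
    ∫⁻ ω, f (fun i => Z (σ i) ω) ∂P = ∫⁻ ω, f (fun i => Z (τ i) ω) ∂P := by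
  have h : ∀ {ρ : κ → ι}, Function.Injective ρ → ∫⁻ ω, f (fun i => Z (ρ i) ω) ∂P =
      ∫⁻ e, f e ∂(Measure.infinitePi fun _ : κ => ν) := by
    intro ρ hρ
    have h1 := (hZ.precomp hρ).map_fun_eq_infinitePi_map (fun i => hm (ρ i))
    simp only [hν] at h1
    rw [← h1, lintegral_map hf (measurable_pi_iff.2 fun i => hm (ρ i))]
  rw [h hσ, h hτ]

/-! ### Uniform displacements -/

theorem volume_box {d : ℕ} (L : ℝ) :
    volume (Set.Icc (fun _ : Fin d => -L) (fun _ => L)) = ENNReal.ofReal (2 * L) ^ d := by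
  rw [Real.volume_Icc_pi]
  simp [two_mul]

theorem volume_box_ne_zero {d : ℕ} {L : ℝ} (hL : 1 / 2 < L) :
    volume (Set.Icc (fun _ : Fin d => -L) (fun _ => L)) ≠ 0 := by
  rw [volume_box]
  exact pow_ne_zero _ (ENNReal.ofReal_pos.2 (by linarith)).ne'

theorem volume_box_ne_top {d : ℕ} (L : ℝ) :
    volume (Set.Icc (fun _ : Fin d => -L) (fun _ => L)) ≠ ∞ := by
  rw [volume_box]
  exact ENNReal.pow_ne_top ENNReal.ofReal_ne_top

/-- The probability that a displacement keeps a particle in the cube of a given neighbour. -/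
noncomputable def slabProb (L : ℝ) : ℝ≥0∞ := ENNReal.ofReal (1 - 1 / (2 * L))

theorem J_zero {d : ℕ} (L : ℝ) : J L (0 : Fin d → ℤ) = Set.Icc (fun _ => -L) (fun _ => L) := by
  simp [J]

theorem prod_slab {d : ℕ} {L : ℝ} (hL : 1 / 2 < L) (i : Fin d) {a b : Fin d → ℝ}
    (hi : b i - a i = 2 * L - 1) (hj : ∀ j ≠ i, b j - a j = 2 * L) :
    volume (Set.Icc a b) / ENNReal.ofReal (2 * L) ^ d = slabProb L := by
  have h0 : 0 < 2 * L := by linarith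
  rw [Real.volume_Icc_pi, ← Finset.mul_prod_erase _ _ (Finset.mem_univ i),
    Finset.prod_congr rfl fun j hj' => by rw [hj j (Finset.ne_of_mem_erase hj')],
    Finset.prod_const, Finset.card_erase_of_mem (Finset.mem_univ i), Finset.card_univ,
    Fintype.card_fin, hi]
  obtain ⟨n, rfl⟩ : ∃ n, d = n + 1 := ⟨d - 1, by have := i.pos; omega⟩
  rw [Nat.add_sub_cancel, pow_succ, mul_comm,
    ENNReal.mul_div_mul_left _ _ (pow_ne_zero _ (ENNReal.ofReal_pos.2 h0).ne')
      (ENNReal.pow_ne_top ENNReal.ofReal_ne_top), slabProb,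
    ← ENNReal.ofReal_div_of_pos h0]
  congr 1
  field_simp

theorem measure_slabOut {d : ℕ} {Ω : Type*} [MeasurableSpace Ω] {P : Measure Ω} {L : ℝ}
    (hL : 1 / 2 < L) {U : Ω → Fin d → ℝ}
    (hU : pdf.IsUniform U (Set.Icc (fun _ => -L) (fun _ => L)) P volume) (i : Fin d) :
    P (U ⁻¹' slabOut L i) = slabProb L := by
  rw [hU.measure_preimage (volume_box_ne_zero hL) (volume_box_ne_top L) (measurableSet_slabOut L i),
    slabOut, ← J_zero, ← Set.inter_assoc, Set.inter_self, J_zero, volume_box, J, Set.Icc_inter_Icc]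
  refine prod_slab hL i ?_ fun j hj => ?_
  · simp only [Pi.inf_apply, Pi.sup_apply, Pi.single_eq_same, Int.cast_one]
    rw [min_eq_left (by linarith), max_eq_right (by linarith)]
    ring
  · simp only [Pi.inf_apply, Pi.sup_apply, Pi.single_eq_of_ne hj, Int.cast_zero]
    simp
    ring

theorem measure_slabIn {d : ℕ} {Ω : Type*} [MeasurableSpace Ω] {P : Measure Ω} {L : ℝ}
    (hL : 1 / 2 < L) {U : Ω → Fin d → ℝ}
    (hU : pdf.IsUniform U (Set.Icc (fun _ => -L) (fun _ => L)) P volume) (i : Fin d) :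
    P (U ⁻¹' slabIn L i) = slabProb L := by
  rw [hU.measure_preimage (volume_box_ne_zero hL) (volume_box_ne_top L) (measurableSet_slabIn L i),
    slabIn, ← J_zero, ← Set.inter_assoc, Set.inter_self, J_zero, volume_box, J, Set.Icc_inter_Icc]
  refine prod_slab hL i ?_ fun j hj => ?_
  · simp only [Pi.inf_apply, Pi.sup_apply, Pi.neg_apply, Pi.single_eq_same, Int.cast_neg,
      Int.cast_one]
    rw [min_eq_right (by linarith), max_eq_left (by linarith)]
    ring
  · simp only [Pi.inf_apply, Pi.sup_apply, Pi.neg_apply, Pi.single_eq_of_ne hj, neg_zero,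
      Int.cast_zero]
    simp
    ring

/-- There are `d ^ t` words, each open with probability `slabProb L ^ (2t)`. The bound `1 / 2 < L`
makes this expectation nonzero, so that it can be inverted. -/
theorem norming_mul {d : ℕ} (hd : d ≠ 0) {L : ℝ} (hL : 1 / 2 < L) (t : ℕ) :
    norming d L t * ((d : ℝ≥0∞) ^ t * (slabProb L ^ t * slabProb L ^ t)) = 1 := by
  have h0 : 0 < 2 * L := by linarith
  have h1 : 0 < 1 - 1 / (2 * L) := by
    rw [sub_pos, div_lt_one h0]
    linarith
  have hd' : (0 : ℝ) < d := by positivity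
  rw [norming, slabProb, ← ENNReal.ofReal_natCast, ← ENNReal.ofReal_pow hd'.le,
    ← ENNReal.ofReal_pow h1.le, ← ENNReal.ofReal_mul (by positivity),
    ← ENNReal.ofReal_mul (by positivity), ← ENNReal.ofReal_mul
      (one_div_nonneg.2 (pow_nonneg (mul_nonneg hd'.le (pHat_nonneg L)) t)), pHat]
  rw [ENNReal.ofReal_eq_one, mul_pow, ← mul_pow (1 - 1 / (2 * L)), ← sq]
  exact one_div_mul_cancel (by positivity)

/-! ### σ-algebras generated by environment variables -/

section Sigma

variable {d : ℕ} {Ω : Type*} {L : ℝ}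

/-- The level at which an environment variable is first seen by oriented paths. -/
def idxLevel : Idx d → ℕ := Sum.elim (fun a => ∑ i, a i + 1) fun b => ∑ i, b.1 i

/-- The σ-algebra of the environment variables with labels in `S`. -/
abbrev envSigma (Z : Idx d → Ω → Fin d → ℝ) (S : Set (Idx d)) : MeasurableSpace Ω :=
  ⨆ i ∈ S, MeasurableSpace.comap (Z i) inferInstance

theorem measurable_envSigma (Z : Idx d → Ω → Fin d → ℝ) {S : Set (Idx d)} {i : Idx d}
    (hi : i ∈ S) : Measurable[envSigma Z S] (Z i) :=
  (comap_measurable (Z i)).mono (le_iSup₂_of_le i hi le_rfl) le_rfl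

theorem measurableSet_envSigma_envOpen (Z : Idx d → Ω → Fin d → ℝ) {t : ℕ} (s : Fin t → Fin d) :
    MeasurableSet[envSigma Z {i | idxLevel i ≤ t}] {ω | EnvOpen L s fun i => Z i ω} := by
  let _ := envSigma Z {i | idxLevel i ≤ t}
  have h1 : ∀ k : Fin t, (Sum.inl (pos s k) : Idx d) ∈ {i | idxLevel i ≤ t} := fun k => by
    simp [idxLevel, sum_pos s k.2.le]
  have h2 : ∀ k : Fin t, (Sum.inr ⟨pos s (k + 1), pos_succ_ne_zero s k⟩ : Idx d) ∈
      {i | idxLevel i ≤ t} := fun k => by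
    simp [idxLevel, sum_pos s k.2]
  refine MeasurableSet.congr (MeasurableSet.iInter fun k : Fin t =>
    (measurable_envSigma Z (h1 k) (measurableSet_slabOut L (s k))).inter
    (measurable_envSigma Z (h2 k) (measurableSet_slabIn L (s k)))) ?_
  ext ω
  simp [EnvOpen]

theorem measurable_envSigma_weight (Z : Idx d → Ω → Fin d → ℝ) (t : ℕ) :
    Measurable[envSigma Z {i | idxLevel i ≤ t}] fun ω => weight L t fun i => Z i ω := by
  let _ := envSigma Z {i | idxLevel i ≤ t}
  have : Measurable fun ω => norming d L t * ∑ s : Fin t → Fin d,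
      {ω | EnvOpen L s fun i => Z i ω}.indicator (1 : Ω → ℝ≥0∞) ω :=
    (Finset.measurable_fun_sum _ fun s _ =>
      measurable_one.indicator (measurableSet_envSigma_envOpen Z s)).const_mul _
  exact this

/-- A path restarted at level `t` uses fresh variables only. At its starting site `Y` belongs to the
bond leading in, and `X` to the bond leading out; the `+ 1` for `X` labels in `idxLevel` records
this. -/
theorem measurable_envSigma_shift (Z : Idx d → Ω → Fin d → ℝ) {t : ℕ} (s : Fin t → Fin d) :
    Measurable[envSigma Z {i | t < idxLevel i}] fun ω i => Z (shiftIdx (pos s t) i) ω := by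
  refine @measurable_pi_lambda _ _ _ (envSigma Z _) _ _ fun i => measurable_envSigma Z ?_
  rcases i with a | b
  · simp [idxLevel, shiftIdx, Finset.sum_add_distrib, sum_pos s le_rfl]
  · have : 0 < ∑ i, b.1 i := by
      refine Nat.pos_of_ne_zero fun h => b.2 ?_
      funext i
      simpa using Finset.sum_eq_zero_iff.1 h i (Finset.mem_univ i)
    simpa [idxLevel, shiftIdx, Finset.sum_add_distrib, sum_pos s le_rfl] using this

end Sigma

/-! ### The law of an environment -/

/-- An environment of independent uniform displacements along the positive orthant. -/
structure IsEnv {d : ℕ} {Ω : Type*} [MeasurableSpace Ω] (P : Measure Ω) (L : ℝ)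
    (Z : Idx d → Ω → Fin d → ℝ) : Prop where
  half_lt : 1 / 2 < L
  measurable : ∀ i, Measurable (Z i)
  uniform : ∀ i, pdf.IsUniform (Z i) (Set.Icc (fun _ => -L) (fun _ => L)) P volume
  indep : iIndepFun Z P

section Env

variable {d : ℕ} {Ω : Type*} [MeasurableSpace Ω] {P : Measure Ω} {L : ℝ}
  {Z : Idx d → Ω → Fin d → ℝ}

theorem IsEnv.measurable_env (h : IsEnv P L Z) : Measurable fun ω i => Z i ω :=
  measurable_pi_iff.2 h.measurable

theorem pos_inl_injective {t : ℕ} (s : Fin t → Fin d) :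
    Function.Injective fun k : Fin t => (Sum.inl (pos s k) : Idx d) := fun k l hkl =>
  Fin.ext (pos_injective s k.2.le l.2.le (Sum.inl_injective hkl))

theorem pos_inr_injective {t : ℕ} (s : Fin t → Fin d) :
    Function.Injective fun k : Fin t =>
      (Sum.inr ⟨pos s (k + 1), pos_succ_ne_zero s k⟩ : Idx d) := fun k l hkl =>
  Fin.ext (Nat.succ_injective (pos_injective s k.2 l.2
    (congrArg Subtype.val (Sum.inr_injective hkl))))

theorem IsEnv.measure_out (h : IsEnv P L Z) {t : ℕ} (s : Fin t → Fin d) :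
    P {ω | ∀ k : Fin t, Z (Sum.inl (pos s k)) ω ∈ slabOut L (s k)} = slabProb L ^ t := by
  rw [measure_forall_mem h.indep (pos_inl_injective s) fun k => measurableSet_slabOut L (s k),
    Finset.prod_congr rfl fun k _ => measure_slabOut h.half_lt (h.uniform _) (s k)]
  simp

theorem IsEnv.measure_in (h : IsEnv P L Z) {t : ℕ} (s : Fin t → Fin d) :
    P {ω | ∀ k : Fin t, Z (Sum.inr ⟨pos s (k + 1), pos_succ_ne_zero s k⟩) ω ∈ slabIn L (s k)} =
      slabProb L ^ t := by
  rw [measure_forall_mem h.indep (pos_inr_injective s) fun k => measurableSet_slabIn L (s k),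
    Finset.prod_congr rfl fun k _ => measure_slabIn h.half_lt (h.uniform _) (s k)]
  simp

theorem IsEnv.measure_envOpen (h : IsEnv P L Z) {t : ℕ} (s : Fin t → Fin d) :
    P {ω | EnvOpen L s fun i => Z i ω} = slabProb L ^ t * slabProb L ^ t := by
  have hj : Function.Injective (Sum.elim (fun k : Fin t => (Sum.inl (pos s k) : Idx d))
      fun k : Fin t => Sum.inr ⟨pos s (k + 1), pos_succ_ne_zero s k⟩) :=
    (pos_inl_injective s).sumElim (pos_inr_injective s) fun _ _ => Sum.inl_ne_inr
  have := measure_forall_mem h.indep hj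
    (C := Sum.elim (fun k => slabOut L (s k)) fun k => slabIn L (s k)) (by
      rintro (k | k)
      · exact measurableSet_slabOut L (s k)
      · exact measurableSet_slabIn L (s k))
  simp only [Sum.forall, Sum.elim_inl, Sum.elim_inr, Fintype.prod_sum_type,
    measure_slabOut h.half_lt (h.uniform _), measure_slabIn h.half_lt (h.uniform _)] at this
  simp only [EnvOpen, forall_and]
  simpa using this

theorem IsEnv.lintegral_weight (hd : d ≠ 0) (h : IsEnv P L Z) (t : ℕ) :
    ∫⁻ ω, weight L t (fun i => Z i ω) ∂P = 1 := by
  simp only [weight]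
  rw [lintegral_const_mul, lintegral_finsetSum]
  · have : ∀ s : Fin t → Fin d,
        ∫⁻ ω, {e | EnvOpen L s e}.indicator 1 (fun i => Z i ω) ∂P =
          slabProb L ^ t * slabProb L ^ t := fun s => by
      rw [← h.measure_envOpen s,
        show {ω | EnvOpen L s fun i => Z i ω} = (fun ω i => Z i ω) ⁻¹' {e | EnvOpen L s e} from rfl,
        ← lintegral_indicator_one (h.measurable_env (measurableSet_envOpen L s))]
      rfl
    simp only [this]
    simpa using norming_mul hd h.half_lt t
  · exact fun s _ => (measurable_one.indicator (measurableSet_envOpen L s)).comp h.measurable_env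
  · exact Finset.measurable_fun_sum _ fun s _ =>
      (measurable_one.indicator (measurableSet_envOpen L s)).comp h.measurable_env

theorem IsEnv.envSigma_le (h : IsEnv P L Z) (S : Set (Idx d)) :
    envSigma Z S ≤ ‹MeasurableSpace Ω› :=
  iSup₂_le fun i _ => (h.measurable i).comap_le

theorem IsEnv.indep_envSigma (h : IsEnv P L Z) {S T : Set (Idx d)} (hST : Disjoint S T) :
    Indep (envSigma Z S) (envSigma Z T) P :=
  indep_iSup_of_disjoint (fun i => (h.measurable i).comap_le) h.indep.iIndep hST

/-- The filtration generated by the environment up to a given level. -/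
def IsEnv.filtration (h : IsEnv P L Z) : Filtration ℕ ‹MeasurableSpace Ω› where
  seq t := envSigma Z {i | idxLevel i ≤ t}
  mono' _ _ hst := biSup_mono fun _ hi => le_trans hi hst
  le' _ := h.envSigma_le _

/-- Integrate `le_limWeight` over `A`. In each summand the event `A` and the openness of the word
depend on levels up to `t`, and the shifted `limWeight` on later ones, so the integral factors and
the second factor is `c`. -/
theorem IsEnv.mul_setLIntegral_weight_le [IsProbabilityMeasure P] (h : IsEnv P L Z) (t : ℕ)
    {A : Set Ω} (hA : MeasurableSet[h.filtration t] A) :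
    (∫⁻ ω, limWeight L (fun i => Z i ω) ∂P) * ∫⁻ ω in A, weight L t (fun i => Z i ω) ∂P ≤
      ∫⁻ ω in A, limWeight L (fun i => Z i ω) ∂P := by
  have hA' : MeasurableSet A := h.filtration.le t _ hA
  set c := ∫⁻ ω, limWeight L (fun i => Z i ω) ∂P with hc
  have hf : ∀ s : Fin t → Fin d, Measurable[envSigma Z {i | idxLevel i ≤ t}]
      (A.indicator fun ω => {e | EnvOpen L s e}.indicator (1 : (Idx d → Fin d → ℝ) → ℝ≥0∞)
        fun i => Z i ω) := by
    intro s
    let _ := envSigma Z {i | idxLevel i ≤ t}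
    have : Measurable ({ω | EnvOpen L s fun i => Z i ω}.indicator (1 : Ω → ℝ≥0∞)) :=
      measurable_one.indicator (measurableSet_envSigma_envOpen Z s)
    exact this.indicator hA
  have key : ∀ s : Fin t → Fin d, ∫⁻ ω in A, {e | EnvOpen L s e}.indicator 1 (fun i => Z i ω) *
      limWeight L (fun i => Z (shiftIdx (pos s t) i) ω) ∂P =
      (∫⁻ ω in A, {e | EnvOpen L s e}.indicator 1 (fun i => Z i ω) ∂P) * c := by
    intro s
    have hc' : c = ∫⁻ ω, limWeight L (fun i => Z (shiftIdx (pos s t) i) ω) ∂P :=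
      lintegral_comp_injective h.indep h.measurable (fun i => h.uniform i)
        Function.injective_id (shiftIdx_injective (pos s t)) (measurable_limWeight L)
    rw [hc',
      ← lintegral_indicator hA', ← lintegral_indicator hA',
      ← lintegral_mul_eq_lintegral_mul_lintegral_of_independent_measurableSpace
      (h.envSigma_le _) (h.envSigma_le _)
      (h.indep_envSigma (S := {i | idxLevel i ≤ t}) (T := {i | t < idxLevel i}) ?_)]
    · refine lintegral_congr fun ω => ?_
      by_cases hω : ω ∈ A <;> simp [hω]
    · exact hf s
    · exact (measurable_limWeight L).comp (measurable_envSigma_shift Z s)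
    · exact Set.disjoint_left.2 fun i hi hi' => by simp at hi hi'; omega
  have hm : ∀ s : Fin t → Fin d,
      Measurable fun ω => {e | EnvOpen L s e}.indicator (1 : (Idx d → Fin d → ℝ) → ℝ≥0∞) (fun i => Z i ω) := fun s =>
    (measurable_one.indicator (measurableSet_envOpen L s)).comp h.measurable_env
  have hm' : ∀ s : Fin t → Fin d,
      Measurable fun ω => limWeight L (fun i => Z (shiftIdx (pos s t) i) ω) := fun s =>
    (measurable_limWeight L).comp (measurable_pi_iff.2 fun i => h.measurable _)
  have hmm : ∀ s : Fin t → Fin d, Measurable fun ω => {e | EnvOpen L s e}.indicator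
      (1 : (Idx d → Fin d → ℝ) → ℝ≥0∞) (fun i => Z i ω) *
        limWeight L (fun i => Z (shiftIdx (pos s t) i) ω) := fun s => (hm s).mul (hm' s)
  refine le_trans (le_of_eq ?_) (lintegral_mono fun ω => le_limWeight L t fun i => Z i ω)
  simp only [weight, Function.comp_def]
  rw [lintegral_const_mul _ (Finset.measurable_fun_sum _ fun s _ => hmm s),
    lintegral_const_mul _ (Finset.measurable_fun_sum _ fun s _ => hm s),
    lintegral_finsetSum _ fun s _ => hmm s, lintegral_finsetSum _ fun s _ => hm s,
    Finset.sum_congr rfl fun s _ => key s, ← Finset.sum_mul]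
  ring

theorem IsEnv.lintegral_limWeight_le_one (hd : d ≠ 0) (h : IsEnv P L Z) :
    ∫⁻ ω, limWeight L (fun i => Z i ω) ∂P ≤ 1 := by
  refine (lintegral_liminf_le fun n => (measurable_weight L n).comp h.measurable_env).trans ?_
  simp [h.lintegral_weight hd]

/-- The one-sided bounds on `A` and `Aᶜ` have the same total `c` on both sides, because `weight` has
mean one. As `c` is finite, neither can be strict. -/
theorem IsEnv.setLIntegral_limWeight [IsProbabilityMeasure P] (hd : d ≠ 0) (h : IsEnv P L Z)
    (t : ℕ) {A : Set Ω} (hA : MeasurableSet[h.filtration t] A) :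
    ∫⁻ ω in A, limWeight L (fun i => Z i ω) ∂P =
      (∫⁻ ω, limWeight L (fun i => Z i ω) ∂P) * ∫⁻ ω in A, weight L t (fun i => Z i ω) ∂P := by
  have hA' : MeasurableSet A := h.filtration.le t _ hA
  refine le_antisymm ?_ (h.mul_setLIntegral_weight_le t hA)
  have h1 := h.mul_setLIntegral_weight_le t hA.compl
  have h2 := lintegral_add_compl (fun ω => limWeight L (fun i => Z i ω)) hA' (μ := P)
  have h3 := lintegral_add_compl (fun ω => weight L t (fun i => Z i ω)) hA' (μ := P)
  rw [h.lintegral_weight hd] at h3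
  have hfin := h.lintegral_limWeight_le_one hd
  set c := ∫⁻ ω, limWeight L (fun i => Z i ω) ∂P
  have hb : ∫⁻ ω in Aᶜ, limWeight L (fun i => Z i ω) ∂P ≠ ∞ :=
    ((setLIntegral_le_lintegral _ _).trans_lt (hfin.trans_lt ENNReal.one_lt_top)).ne
  refine (ENNReal.add_le_add_iff_right hb).1 ?_
  calc _ = c * 1 := by rw [h2, mul_one]
    _ = c * ∫⁻ ω in A, weight L t (fun i => Z i ω) ∂P +
        c * ∫⁻ ω in Aᶜ, weight L t (fun i => Z i ω) ∂P := by rw [← h3, mul_add]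
    _ ≤ _ := by gcongr

theorem IsEnv.integrable_weight (hd : d ≠ 0) (h : IsEnv P L Z) (t : ℕ) :
    Integrable (fun ω => (weight L t fun i => Z i ω).toReal) P :=
  integrable_toReal_of_lintegral_ne_top
    ((measurable_weight L t).comp h.measurable_env).aemeasurable
    (by simp [h.lintegral_weight hd])

/-- If the normalized numbers of paths do not vanish in the limit, they converge in `L¹`. -/
theorem IsEnv.exists_tendsto_eLpNorm [IsProbabilityMeasure P] (hd : d ≠ 0) (h : IsEnv P L Z)
    (h0 : ∫⁻ ω, limWeight L (fun i => Z i ω) ∂P ≠ 0) :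
    ∃ g : Ω → ℝ, Integrable g P ∧ (∀ ω, 0 ≤ g ω) ∧
      Tendsto (fun t => eLpNorm ((fun ω => (weight L t fun i => Z i ω).toReal) - g) 1 P)
        atTop (𝓝 0) := by
  set c := ∫⁻ ω, limWeight L (fun i => Z i ω) ∂P with hc
  have hctop : c ≠ ∞ := ((h.lintegral_limWeight_le_one hd).trans_lt ENNReal.one_lt_top).ne
  have hc0 : c.toReal ≠ 0 := ENNReal.toReal_ne_zero.2 ⟨h0, hctop⟩
  have hm : Measurable fun ω => limWeight L fun i => Z i ω :=
    (measurable_limWeight L).comp h.measurable_env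
  have hwm : ∀ t, Measurable fun ω => weight L t fun i => Z i ω := fun t =>
    (measurable_weight L t).comp h.measurable_env
  set f : Ω → ℝ := fun ω => (limWeight L fun i => Z i ω).toReal with hf
  have hfi : Integrable f P := integrable_toReal_of_lintegral_ne_top hm.aemeasurable hctop
  set w : ℕ → Ω → ℝ := fun t ω => (weight L t fun i => Z i ω).toReal with hw
  have hwi : ∀ t, Integrable (w t) P := h.integrable_weight hd
  have hwF : ∀ t, Measurable[h.filtration t] fun ω => weight L t fun i => Z i ω :=
    fun t => measurable_envSigma_weight Z t
  -- The set identity just proved says that `c W_t` is the conditional expectation of `W` given the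
  -- first `t` levels.
  have hcond : ∀ t, c.toReal • w t =ᵐ[P] P[f | h.filtration t] := by
    intro t
    refine ae_eq_condExp_of_forall_setIntegral_eq (h.filtration.le t) hfi
      (fun A hA _ => ((hwi t).smul _).integrableOn) (fun A hA _ => ?_) ?_
    · have hlt : ∀ᵐ ω ∂P.restrict A, (limWeight L fun i => Z i ω) < ∞ :=
        ae_restrict_of_ae (ae_lt_top hm hctop)
      simp only [Pi.smul_apply]
      rw [integral_smul, hf, hw, integral_toReal hm.aemeasurable hlt,
        integral_toReal (hwm t).aemeasurable (Eventually.of_forall fun ω =>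
          (weight_ne_top L t _).lt_top), h.setLIntegral_limWeight hd t hA, ENNReal.toReal_mul,
        smul_eq_mul]
    · exact (((hwF t).ennreal_toReal.stronglyMeasurable).const_smul _).aestronglyMeasurable
  have hle : ∀ t, (h.filtration t : MeasurableSpace Ω) ≤ ⨆ n, h.filtration n := fun t =>
    le_iSup (fun n => (h.filtration n : MeasurableSpace Ω)) t
  -- Measurability with respect to the limit σ-algebra makes the Lévy limit `f` itself, rather than
  -- a conditional expectation of it.
  have hsup : StronglyMeasurable[⨆ t, h.filtration t] f := by
    let _ : MeasurableSpace Ω := ⨆ t, h.filtration t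
    have : Measurable f :=
      (Measurable.liminf fun t => (hwF t).mono (hle t) le_rfl).ennreal_toReal
    exact this.stronglyMeasurable
  have hlim := hfi.tendsto_eLpNorm_condExp hsup
  refine ⟨c.toReal⁻¹ • f, hfi.smul _, fun ω => by
    simp only [Pi.smul_apply, smul_eq_mul, hf]; positivity, ?_⟩
  have heq : ∀ t, eLpNorm (w t - c.toReal⁻¹ • f) 1 P =
      ‖c.toReal⁻¹‖ₑ * eLpNorm (P[f | h.filtration t] - f) 1 P := by
    intro t
    rw [← eLpNorm_congr_ae ((hcond t).sub (EventuallyEq.refl _ f)), ← eLpNorm_const_smul]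
    congr 1
    rw [smul_sub, smul_smul, inv_mul_cancel₀ hc0, one_smul]
  refine Tendsto.congr (fun t => (heq t).symm) ?_
  simpa using ENNReal.Tendsto.const_mul hlim (Or.inr enorm_ne_top)

end Env

/-! ### The configuration space -/

theorem locallyFin_iff {d : ℕ} {ι : Type*} {x : ι → Fin d → ℝ} :
    LocallyFin x ↔ ∀ n : ℕ, (x ⁻¹' Metric.closedBall 0 n).Finite := by
  refine ⟨fun h n => h _ (isCompact_closedBall _ _), fun h K hK => ?_⟩
  obtain ⟨r, hr⟩ := hK.isBounded.subset_closedBall 0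
  obtain ⟨n, hn⟩ := exists_nat_ge r
  exact (h n).subset (Set.preimage_mono (hr.trans (Metric.closedBall_subset_closedBall hn)))

theorem measurable_sum_dirac {d : ℕ} {ι : Type*} [Countable ι] {K : Set (Fin d → ℝ)}
    (hK : MeasurableSet K) :
    Measurable fun x : ι → Fin d → ℝ => (Measure.sum fun j => Measure.dirac (x j)) K := by
  simp only [Measure.sum_apply _ hK, Measure.dirac_apply' _ hK]
  exact Measurable.tsum fun j =>
    (measurable_one.indicator hK).comp (measurable_pi_apply j)

theorem measurableSet_locallyFin {d : ℕ} {ι : Type*} [Countable ι] :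
    MeasurableSet {x : ι → Fin d → ℝ | LocallyFin x} := by
  refine MeasurableSet.congr (MeasurableSet.iInter fun n : ℕ => measurableSet_lt
    (measurable_sum_dirac (ι := ι) (Metric.isClosed_closedBall (x := (0 : Fin d → ℝ))
      (ε := n)).measurableSet) (measurable_const (a := ∞))) ?_
  ext x
  simp [locallyFin_iff, sum_dirac_apply x Metric.isClosed_closedBall.measurableSet]

open Classical in
theorem proj_apply {d : ℕ} {ι : Type*} (x : ι → Fin d → ℝ) (K : Set (Fin d → ℝ)) :
    (proj x).1 K =
      if LocallyFin x then (Measure.sum fun j => Measure.dirac (x j)) K else 0 := by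
  by_cases h : LocallyFin x
  · have hp : proj x = ⟨_, isConf_sum_dirac h⟩ := dif_pos h
    rw [hp, if_pos h]
  · have hp : proj x = emptyConf d := dif_neg h
    rw [hp, if_neg h]
    rfl

theorem measurable_proj {d : ℕ} {ι : Type*} [Countable ι] :
    Measurable (proj : (ι → Fin d → ℝ) → Conf d) := by
  refine measurable_iff_comap_le.2 ?_
  simp only [instMeasurableSpaceConf, MeasurableSpace.comap_iSup, MeasurableSpace.comap_comp]
  refine iSup₂_le fun K hK => measurable_iff_comap_le.1 ?_
  simp only [Function.comp_def, proj_apply]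
  exact Measurable.ite measurableSet_locallyFin (measurable_sum_dirac hK.measurableSet)
    measurable_const

theorem locallyFin_comp_iff {d : ℕ} {ι κ : Type*} (x : ι → Fin d → ℝ) {φ : κ → ι}
    (hφ : Function.Injective φ) (hfin : (Set.range φ)ᶜ.Finite) :
    LocallyFin (x ∘ φ) ↔ LocallyFin x := by
  refine forall₂_congr fun K _ => ⟨fun h => ?_, fun h => ?_⟩
  · refine ((h.image φ).union hfin).subset fun i hi => ?_
    by_cases hr : i ∈ Set.range φ
    · obtain ⟨k, rfl⟩ := hr
      exact Or.inl ⟨k, hi, rfl⟩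
    · exact Or.inr hr
  · exact Set.Finite.preimage (f := φ) hφ.injOn h

/-- Points outside of `K` do not contribute to the number of points in `K`. -/
theorem proj_comp_apply {d : ℕ} {ι κ : Type*} (x : ι → Fin d → ℝ) {φ : κ → ι}
    (hφ : Function.Injective φ) (hfin : (Set.range φ)ᶜ.Finite) {K : Set (Fin d → ℝ)}
    (hK : MeasurableSet K) (hx : ∀ i ∉ Set.range φ, x i ∉ K) :
    (proj (x ∘ φ)).1 K = (proj x).1 K := by
  classical
  -- Only finitely many labels are dropped, so the two families are locally finite together and the
  -- default value of `proj` causes no discrepancy.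
  simp only [proj_apply, locallyFin_comp_iff x hφ hfin, sum_dirac_apply _ hK]
  have hsub : x ⁻¹' K ⊆ Set.range φ := fun i hi => by
    by_contra hr
    exact hx i hr hi
  rw [Set.preimage_comp, ← hφ.encard_image, Set.image_preimage_eq_of_subset hsub]

/-- A set of configurations that only depends on the numbers of points in subsets of `K`. -/
def IsLocal {d : ℕ} (A : Set (Conf d)) (K : Set (Fin d → ℝ)) : Prop :=
  ∀ ξ ξ' : Conf d, (∀ K' ⊆ K, MeasurableSet K' → ξ.1 K' = ξ'.1 K') → (ξ ∈ A ↔ ξ' ∈ A)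

/-- Finite intersections of events on the counts `ξ(K)` form a π-system generating the σ-algebra,
and each is local in the union of the compact sets involved. The whole space is local in `∅`, which
gives equality of total masses. -/
theorem measure_ext_of_isLocal {d : ℕ} {μ ν : Measure (Conf d)} [IsFiniteMeasure μ]
    (h : ∀ A K, MeasurableSet A → IsCompact K → IsLocal A K → μ A = ν A) : μ = ν := by
  refine ext_of_generate_finite _
    (generateFrom_piiUnionInter_measurableSet (fun K : Set (Fin d → ℝ) =>
      MeasurableSpace.comap (fun ξ : Conf d => ξ.1 K) inferInstance) {K | IsCompact K}).symm
    (isPiSystem_piiUnionInter _ (fun K => @MeasurableSpace.isPiSystem_measurableSet _ (_)) _)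
    ?_ (h _ ∅ MeasurableSet.univ isCompact_empty fun _ _ _ => by simp)
  rintro A ⟨F, hF, f, hf, rfl⟩
  refine h _ (⋃ K ∈ F, K) ?_ (F.isCompact_biUnion fun K hK => hF hK) fun ξ ξ' hξ => ?_
  · refine Finset.measurableSet_biInter _ fun K hK => ?_
    have : MeasurableSpace.comap (fun ξ : Conf d => ξ.1 K) inferInstance ≤
        instMeasurableSpaceConf d := le_iSup₂_of_le K (hF hK) le_rfl
    exact this _ (hf K hK)
  · simp only [Set.mem_iInter]
    refine forall₂_congr fun K hK => ?_
    obtain ⟨B, -, hB⟩ := hf K hK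
    rw [← hB, Set.mem_preimage, Set.mem_preimage, hξ K (Set.subset_biUnion_of_mem (u := id) hK)
      (IsCompact.measurableSet (hF hK))]

/-! ### Open paths as words -/

/-- The oriented lattice path with steps `s`. -/
def wordPath {d t : ℕ} (s : Fin t → Fin d) : Gam d t :=
  ⟨fun k => toZ (pos s k), by simp [pos_zero, toZ_zero], fun k l h => Fin.ext
    (pos_injective s (Nat.lt_succ_iff.1 k.2) (Nat.lt_succ_iff.1 l.2) (toZ_injective h))⟩

theorem wordPath_injective {d t : ℕ} : Function.Injective (wordPath (d := d) (t := t)) :=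
  fun _ _ h => word_ext fun k hk =>
    toZ_injective (congrFun (congrArg Subtype.val h) ⟨k, Nat.lt_succ_of_le hk⟩)

theorem mem_level {d t : ℕ} (s : Fin t → Fin d) : toZ (pos s t) ∈ level d t := by
  refine ⟨fun i => Int.natCast_nonneg _, ?_⟩
  have := sum_pos s le_rfl
  simp only [toZ, Nat.abs_cast]
  exact_mod_cast this

section Model

variable {d : ℕ} {Ω : Type*} (L : ℝ) (X : (Fin d → ℤ) → Ω → Fin d → ℝ)
  (Y : {z : Fin d → ℤ // z ≠ 0} → Ω → Fin d → ℝ)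

/-- The displacements seen along oriented paths. -/
def envOf : Idx d → Ω → Fin d → ℝ :=
  Sum.elim (fun a => X (toZ a)) fun b => Y ⟨toZ b.1, toZ_ne_zero b.2⟩

theorem pt_add_mem_J (z w : Fin d → ℤ) (x : Fin d → ℝ) :
    pt z + x ∈ J L w ↔ x ∈ J L (w - z) := by
  simp only [J, pt, Set.mem_Icc, Pi.le_def, Pi.add_apply, Pi.sub_apply, Int.cast_sub]
  refine and_congr (forall_congr' fun i => ?_) (forall_congr' fun i => ?_) <;>
    constructor <;> intro h <;> linarith

theorem pt_add_mem_slabOut (z : Fin d → ℤ) (i : Fin d) (x : Fin d → ℝ) :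
    pt z + x ∈ J L z ∩ J L (z + Pi.single i 1) ↔ x ∈ slabOut L i := by
  simp [slabOut, pt_add_mem_J]

theorem pt_add_mem_slabIn (z : Fin d → ℤ) (i : Fin d) (x : Fin d → ℝ) :
    pt (z + Pi.single i 1) + x ∈ J L z ∩ J L (z + Pi.single i 1) ↔ x ∈ slabIn L i := by
  simp [slabIn, pt_add_mem_J, and_comm]

theorem bondOpen_pos_iff {t : ℕ} (s : Fin t → Fin d) (k : Fin t) (ω : Ω) :
    BondOpen L X Y (toZ (pos s k)) (toZ (pos s (k + 1))) ω ↔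
      envOf X Y (Sum.inl (pos s k)) ω ∈ slabOut L (s k) ∧
        envOf X Y (Sum.inr ⟨pos s (k + 1), pos_succ_ne_zero s k⟩) ω ∈ slabIn L (s k) := by
  have h1 : ∑ i, |toZ (pos s k) i - toZ (pos s (k + 1)) i| = 1 := by
    simp [toZ_pos_succ, Pi.single_apply, abs_ite]
  have h2 : toZ (pos s (k + 1)) ≠ 0 := toZ_ne_zero (pos_succ_ne_zero s k)
  simp only [BondOpen, h1, latticeX, latticeY, envOf, Sum.elim_inl, Sum.elim_inr, true_and]
  simp only [h2, ne_eq, not_false_eq_true, exists_true_left]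
  simp only [← pt_add_mem_slabOut L (toZ (pos s k)), ← pt_add_mem_slabIn L (toZ (pos s k)),
    ← toZ_pos_succ]

theorem mem_pathEvent_wordPath {t : ℕ} (s : Fin t → Fin d) (ω : Ω) :
    ω ∈ pathEvent L X Y (wordPath s) ↔ EnvOpen L s fun i => envOf X Y i ω := by
  have h : (wordPath s).1 (Fin.last t) ∈ level d t := mem_level s
  simp only [pathEvent, Set.mem_ofPred_eq, h, and_true, EnvOpen]
  exact forall_congr' fun k => bondOpen_pos_iff L X Y s k ω

/-- A path of unit steps from the origin to level `t` in `t` steps is oriented. -/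
theorem eq_wordPath {t : ℕ} (γ : Gam d t)
    (h1 : ∀ k : Fin t, ∑ i, |γ.1 k.castSucc i - γ.1 k.succ i| = 1)
    (h2 : γ.1 (Fin.last t) ∈ level d t) : ∃ s, wordPath s = γ := by
  -- The coordinate sum grows by at most one per step and must gain `t` in `t` steps, so each step
  -- gains exactly one. The signed and absolute sums of the increments of a step then coincide, so
  -- all increments are nonnegative.
  have hle : ∀ k : Fin t, ∑ i, (γ.1 k.succ i - γ.1 k.castSucc i) ≤ 1 := fun k => by
    rw [← h1 k]
    refine Finset.sum_le_sum fun i _ => ?_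
    rw [abs_sub_comm]
    exact le_abs_self _
  have hsum : ∑ k : Fin t, ∑ i, (γ.1 k.succ i - γ.1 k.castSucc i) = ∑ k : Fin t, (1 : ℤ) := by
    rw [Finset.sum_comm]
    have h3 : ∀ i, ∑ k : Fin t, (γ.1 k.succ i - γ.1 k.castSucc i) = γ.1 (Fin.last t) i := by
      intro i
      have := Fin.sum_univ_succ fun k => γ.1 k i
      rw [Fin.sum_univ_castSucc] at this
      rw [Finset.sum_sub_distrib]
      simp only [γ.2.1, Pi.zero_apply] at this
      linarith
    have h4 := h2.2
    simp only [abs_of_nonneg (h2.1 _)] at h4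
    simp [h3, h4]
  have heq : ∀ k : Fin t, ∑ i, (γ.1 k.succ i - γ.1 k.castSucc i) = 1 := fun k =>
    (Finset.sum_eq_sum_iff_of_le fun k _ => hle k).1 hsum k (Finset.mem_univ k)
  have hstep : ∀ k : Fin t, ∃ i, γ.1 k.succ = γ.1 k.castSucc + Pi.single i 1 := by
    intro k
    have habs : ∀ i, γ.1 k.succ i - γ.1 k.castSucc i = |γ.1 k.castSucc i - γ.1 k.succ i| := by
      have := (Finset.sum_eq_sum_iff_of_le (s := Finset.univ) fun i _ => by
        rw [abs_sub_comm]; exact le_abs_self (γ.1 k.succ i - γ.1 k.castSucc i)).1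
        ((heq k).trans (h1 k).symm)
      exact fun i => this i (Finset.mem_univ i)
    have hnn : ∀ i, 0 ≤ γ.1 k.succ i - γ.1 k.castSucc i := fun i => by
      rw [habs]; positivity
    obtain ⟨i, hi⟩ : ∃ i, γ.1 k.succ i - γ.1 k.castSucc i ≠ 0 := by
      by_contra! hall
      simpa [hall] using heq k
    have hs := heq k
    rw [← Finset.add_sum_erase _ _ (Finset.mem_univ i)] at hs
    have hr : 0 ≤ ∑ j ∈ Finset.univ.erase i, (γ.1 k.succ j - γ.1 k.castSucc j) :=
      Finset.sum_nonneg fun j _ => hnn j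
    have hi1 := hnn i
    have hr0 : ∑ j ∈ Finset.univ.erase i, (γ.1 k.succ j - γ.1 k.castSucc j) = 0 := by omega
    refine ⟨i, funext fun j => ?_⟩
    by_cases hj : j = i
    · subst hj
      simp only [Pi.add_apply, Pi.single_eq_same]
      omega
    · have := (Finset.sum_eq_zero_iff_of_nonneg fun j _ => hnn j).1 hr0 j (by simp [hj])
      simp only [Pi.add_apply, Pi.single_eq_of_ne hj]
      omega
  choose s hs using hstep
  exact ⟨s, Subtype.ext (funext fun k => (eq_toZ_pos γ.2.1 hs k).symm)⟩

theorem pathEvent_eq_empty {t : ℕ} {γ : Gam d t} (hγ : γ ∉ Set.range (wordPath (d := d))) :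
    pathEvent L X Y γ = ∅ := by
  refine Set.eq_empty_of_forall_notMem fun ω hω => hγ ?_
  exact eq_wordPath γ (fun k => (hω.1 k).1) hω.2

end Model

/-! ### Counting open paths -/

theorem tail_add_single_zero {m : ℕ} (a : Fin (m + 1) → ℕ) :
    Fin.tail (a + Pi.single 0 1) = Fin.tail a := by
  funext j
  simp [Fin.tail]

theorem tail_add_single_succ {m : ℕ} (a : Fin (m + 1) → ℕ) (i : Fin m) :
    Fin.tail (a + Pi.single i.succ 1) = Fin.tail a + Pi.single i 1 := by
  funext j
  simp [Fin.tail, Pi.single_apply]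

theorem embed_tail_pos {m t : ℕ} (s : Fin t → Fin (m + 1)) {k : ℕ} (hk : k ≤ t) :
    embed (k : ℤ) (Fin.tail (pos s k)) = toZ (pos s k) := by
  funext i
  refine Fin.cases ?_ (fun i => ?_) i
  · have := sum_pos s hk
    rw [Fin.sum_univ_succ] at this
    simp only [embed, Fin.cons_zero, toZ, Fin.tail]
    rw [← Nat.cast_sum]
    omega
  · simp [embed, toZ, Fin.tail]

section Model

variable {Ω : Type*} (L : ℝ)

/-- Time-space sites are lattice sites with coordinate `0` dropped; the level recovers it through
`embed_tail_pos`. A step in direction `0` becomes staying put, and a step in direction `i.succ`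
becomes adding `e_i`. -/
theorem numPaths_eq {m : ℕ} (X : (Fin (m + 1) → ℤ) → Ω → Fin (m + 1) → ℝ)
    (Y : {z : Fin (m + 1) → ℤ // z ≠ 0} → Ω → Fin (m + 1) → ℝ) (t : ℕ) (ω : Ω) :
    numPaths L X Y t ω =
      Set.ncard {s : Fin t → Fin (m + 1) | EnvOpen L s fun i => envOf X Y i ω} := by
  have hinj : Function.Injective fun (s : Fin t → Fin (m + 1)) (k : Fin (t + 1)) =>
      Fin.tail (pos s k) := fun s u h => word_ext fun k hk => toZ_injective (by
    rw [← embed_tail_pos s hk, ← embed_tail_pos u hk,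
      show Fin.tail (pos s k) = Fin.tail (pos u k) from
        congrFun h ⟨k, Nat.lt_succ_of_le hk⟩])
  have heta : ∀ (s : Fin t → Fin (m + 1)) (l : Fin t),
      EtaHat L X Y ((l : ℕ) + 1) (Fin.tail (pos s l)) (Fin.tail (pos s (l + 1))) ω ↔
        BondOpen L X Y (toZ (pos s l)) (toZ (pos s (l + 1))) ω := fun s l => by
    rw [EtaHat, embed_tail_pos s l.2, Nat.cast_add_one, add_sub_cancel_right,
      embed_tail_pos s l.2.le]
  rw [numPaths, ← Set.ncard_image_of_injective _ hinj]
  congr 1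
  ext z
  constructor
  · rintro ⟨h0, hz⟩
    have hstep : ∀ l : Fin t, ∃ i : Fin (m + 1), ∀ a : Fin (m + 1) → ℕ,
        Fin.tail a = z l.castSucc → Fin.tail (a + Pi.single i 1) = z l.succ := by
      intro l
      rcases (hz l).1 with h | ⟨i, h⟩
      · exact ⟨0, fun a ha => by rw [tail_add_single_zero, ha, h]⟩
      · exact ⟨i.succ, fun a ha => by rw [tail_add_single_succ, ha, h]⟩
    choose s hs using hstep
    have hzs : ∀ k : Fin (t + 1), Fin.tail (pos s k) = z k := by
      intro k
      induction k using Fin.induction with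
      | zero =>
        rw [h0, Fin.val_zero, pos_zero]
        rfl
      | succ k ih =>
        rw [Fin.val_succ, pos_succ]
        exact hs k _ ih
    refine ⟨s, fun l => (bondOpen_pos_iff L X Y s l ω).1 ((heta s l).1 ?_), funext hzs⟩
    have h1 := hzs l.castSucc
    have h2 := hzs l.succ
    rw [Fin.val_castSucc] at h1
    rw [Fin.val_succ] at h2
    rw [h1, h2]
    exact (hz l).2
  · rintro ⟨s, hs, rfl⟩
    refine ⟨?_, fun l => ⟨?_, (heta s l).2 ((bondOpen_pos_iff L X Y s l ω).2 (hs l))⟩⟩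
    · simp only [Fin.val_zero, pos_zero]
      rfl
    · simp only [Fin.val_succ, Fin.val_castSucc, pos_succ]
      generalize s l = i
      refine Fin.cases ?_ (fun i => ?_) i
      · exact Or.inl (tail_add_single_zero _)
      · exact Or.inr ⟨i, tail_add_single_succ _ i⟩

theorem numPathsBar_eq {m : ℕ} (X : (Fin (m + 1) → ℤ) → Ω → Fin (m + 1) → ℝ)
    (Y : {z : Fin (m + 1) → ℤ // z ≠ 0} → Ω → Fin (m + 1) → ℝ) (t : ℕ) (ω : Ω) :
    numPathsBar L X Y t ω = (weight L t fun i => envOf X Y i ω).toReal := by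
  classical
  have h : (0 : ℝ) ≤ 1 / (((m + 1 : ℕ) : ℝ) * pHat L) ^ t :=
    one_div_nonneg.2 (pow_nonneg (mul_nonneg (Nat.cast_nonneg _) (pHat_nonneg L)) t)
  rw [numPathsBar, numPaths_eq, weight, norming, ENNReal.toReal_mul, ENNReal.toReal_ofReal h,
    Set.ncard_eq_toFinset_card']
  simp only [Set.indicator_apply, Pi.one_apply, Finset.sum_boole, ENNReal.toReal_natCast]
  rw [div_eq_mul_one_div, mul_comm]
  congr 3
  ext s
  simp

/-! ### The restricted measures as sums over words -/

variable {d : ℕ} [MeasurableSpace Ω] {P : Measure Ω} {X : (Fin d → ℤ) → Ω → Fin d → ℝ}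
  {Y : {z : Fin d → ℤ // z ≠ 0} → Ω → Fin d → ℝ}

/-- Paths that are not words have empty path event, so the sum over `Gam d t` collapses to a finite
one. Allowing `Λ` to differ from the path event by a null set covers both lattices at once. -/
theorem sum_restrict_map_apply {t : ℕ} {Φ : Ω → Conf d} (hΦ : Measurable Φ)
    {Λ : Gam d t → Set Ω} (hΛ : ∀ γ, Λ γ =ᵐ[P] pathEvent L X Y γ)
    {A : Set (Conf d)} (hA : MeasurableSet A) :
    (norming d L t • Measure.sum fun γ => (P.restrict (Λ γ)).map Φ) A =
      norming d L t * ∑ s : Fin t → Fin d, P (Φ ⁻¹' A ∩ {ω | EnvOpen L s fun i => envOf X Y i ω})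
      := by
  rw [Measure.smul_apply, smul_eq_mul, Measure.sum_apply _ hA, ← tsum_fintype (L := .unconditional _)]
  congr 1
  have h1 : ∀ γ : Gam d t, ((P.restrict (Λ γ)).map Φ) A = P (Φ ⁻¹' A ∩ pathEvent L X Y γ) :=
    fun γ => by
      rw [Measure.map_apply hΦ hA, Measure.restrict_congr_set (hΛ γ),
        Measure.restrict_apply (hΦ hA)]
  simp only [h1]
  rw [← wordPath_injective.tsum_eq]
  · refine tsum_congr fun s => ?_
    congr 2
    ext ω
    exact mem_pathEvent_wordPath L X Y s ω
  · intro γ hγ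
    by_contra hr
    simp [pathEvent_eq_empty L X Y hr] at hγ

theorem setLIntegral_weight {t : ℕ} (hm : Measurable fun ω i => envOf X Y i ω)
    (B : Set Ω) :
    ∫⁻ ω in B, weight L t (fun i => envOf X Y i ω) ∂P =
      norming d L t * ∑ s : Fin t → Fin d, P (B ∩ {ω | EnvOpen L s fun i => envOf X Y i ω}) := by
  have hms : ∀ s : Fin t → Fin d, MeasurableSet {ω | EnvOpen L s fun i => envOf X Y i ω} :=
    fun s => hm (measurableSet_envOpen L s)
  have h : ∀ ω, weight L t (fun i => envOf X Y i ω) = norming d L t * ∑ s : Fin t → Fin d,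
      {ω | EnvOpen L s fun i => envOf X Y i ω}.indicator 1 ω := fun ω => rfl
  simp only [h]
  rw [lintegral_const_mul, lintegral_finsetSum]
  · congr 1
    refine Finset.sum_congr rfl fun s _ => ?_
    rw [lintegral_indicator_one (hms s), Measure.restrict_apply (hms s), Set.inter_comm]
  · exact fun s _ => measurable_one.indicator (hms s)
  · exact Finset.measurable_fun_sum _ fun s _ => measurable_one.indicator (hms s)

/-- Independent uniform displacements of all lattice points. -/
structure IsModel (P : Measure Ω) (L : ℝ) (X : (Fin d → ℤ) → Ω → Fin d → ℝ)
    (Y : {z : Fin d → ℤ // z ≠ 0} → Ω → Fin d → ℝ) : Prop where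
  half_lt : 1 / 2 < L
  measurable_X : ∀ z, Measurable (X z)
  measurable_Y : ∀ z, Measurable (Y z)
  uniform_X : ∀ z, pdf.IsUniform (X z) (Set.Icc (fun _ => -L) (fun _ => L)) P volume
  uniform_Y : ∀ z, pdf.IsUniform (Y z) (Set.Icc (fun _ => -L) (fun _ => L)) P volume
  indep : iIndepFun (Sum.elim X Y) P

variable {L}

theorem IsModel.isEnv (h : IsModel P L X Y) : IsEnv P L (envOf X Y) where
  half_lt := h.half_lt
  measurable := by
    rintro (a | b)
    · exact h.measurable_X _
    · exact h.measurable_Y _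
  uniform := by
    rintro (a | b)
    · exact h.uniform_X _
    · exact h.uniform_Y _
  indep := by
    have hinj : Function.Injective (Sum.map toZ fun b => ⟨toZ b.1, toZ_ne_zero b.2⟩ :
        Idx d → (Fin d → ℤ) ⊕ {z : Fin d → ℤ // z ≠ 0}) :=
      Sum.map_injective.2 ⟨toZ_injective, fun a b hab =>
        Subtype.ext (toZ_injective (congrArg Subtype.val hab))⟩
    convert h.indep.precomp hinj using 1
    funext i
    rcases i with a | b <;> rfl

theorem ae_mem_box (hL : 1 / 2 < L) {U : Ω → Fin d → ℝ}
    (hU : pdf.IsUniform U (Set.Icc (fun _ => -L) (fun _ => L)) P volume) :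
    ∀ᵐ ω ∂P, U ω ∈ J L (0 : Fin d → ℤ) := by
  rw [J_zero]
  have := hU.measure_preimage (volume_box_ne_zero hL) (volume_box_ne_top L)
    (measurableSet_Icc (a := fun _ : Fin d => -L) (b := fun _ => L)).compl
  rw [Set.inter_compl_self, measure_empty, ENNReal.zero_div] at this
  exact this

theorem IsModel.ae_latticeX (h : IsModel P L X Y) : ∀ᵐ ω ∂P, ∀ z, latticeX X ω z ∈ J L z := by
  refine ae_all_iff.2 fun z => ?_
  filter_upwards [ae_mem_box h.half_lt (h.uniform_X z)] with ω hω
  rwa [latticeX, pt_add_mem_J, sub_self]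

theorem IsModel.ae_latticeY (h : IsModel P L X Y) :
    ∀ᵐ ω ∂P, ∀ z : {z : Fin d → ℤ // z ≠ 0}, latticeY Y ω z ∈ J L z.1 := by
  refine ae_all_iff.2 fun z => ?_
  filter_upwards [ae_mem_box h.half_lt (h.uniform_Y z)] with ω hω
  rwa [latticeY, pt_add_mem_J, sub_self]

theorem IsModel.measurable_latticeX (h : IsModel P L X Y) : Measurable (latticeX X) :=
  measurable_pi_iff.2 fun z => (h.measurable_X z).const_add _

theorem IsModel.measurable_latticeY (h : IsModel P L X Y) : Measurable (latticeY Y) :=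
  measurable_pi_iff.2 fun z => (h.measurable_Y z).const_add _

theorem IsModel.mu_apply (h : IsModel P L X Y) (t : ℕ) {A : Set (Conf d)}
    (hA : MeasurableSet A) :
    mu P L X Y t A = norming d L t * ∑ s : Fin t → Fin d,
      P ((fun ω => proj (latticeX X ω)) ⁻¹' A ∩ {ω | EnvOpen L s fun i => envOf X Y i ω}) := by
  refine sum_restrict_map_apply L (measurable_proj.comp h.measurable_latticeX) (fun γ => ?_)
    hA
  rw [eventuallyEq_set]
  filter_upwards [h.ae_latticeX] with ω hω
  -- The labelled lattice itself is the preimage witnessing membership in `Π(A_γ)`: open bonds give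
  -- the constraints on the path, and the almost sure bound gives those off it.
  refine ⟨fun hγ => hγ.2, fun hγ => ⟨⟨_, ⟨fun k => (hγ.1 k).2.1, fun z _ => hω z⟩, rfl⟩, hγ⟩⟩

theorem IsModel.muZero_apply (h : IsModel P L X Y) (t : ℕ) {A : Set (Conf d)}
    (hA : MeasurableSet A) :
    muZero P L X Y t A = norming d L t * ∑ s : Fin t → Fin d,
      P ((fun ω => proj (latticeY Y ω)) ⁻¹' A ∩ {ω | EnvOpen L s fun i => envOf X Y i ω}) := by
  refine sum_restrict_map_apply L (measurable_proj.comp h.measurable_latticeY) (fun γ => ?_)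
    hA
  rw [eventuallyEq_set]
  filter_upwards [h.ae_latticeY] with ω hω
  refine ⟨fun hγ => hγ.2, fun hγ => ⟨⟨_, ⟨?_, fun z _ => hω z⟩, rfl⟩, hγ⟩⟩
  rintro ⟨z, hz⟩ k rfl
  exact (hγ.1 k).2.2.2

end Model

/-! ### Total variation -/

theorem ofReal_abs_sub_le_tvDist {E : Type*} [MeasurableSpace E] (μ ν : Measure E) {A : Set E}
    (hA : MeasurableSet A) : ENNReal.ofReal |μ.real A - ν.real A| ≤ tvDist μ ν :=
  le_iSup₂_of_le (f := fun (A : Set E) (_ : MeasurableSet A) =>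
    ENNReal.ofReal |μ.real A - ν.real A|) A hA le_rfl

theorem tendsto_real_of_tvDist {E : Type*} [MeasurableSpace E] {μ : ℕ → Measure E}
    {ν : Measure E} (h : Tendsto (fun t => tvDist (μ t) ν) atTop (𝓝 0)) {A : Set E}
    (hA : MeasurableSet A) : Tendsto (fun t => (μ t).real A) atTop (𝓝 (ν.real A)) := by
  rw [tendsto_iff_dist_tendsto_zero]
  have := tendsto_of_tendsto_of_tendsto_of_le_of_le tendsto_const_nhds h (fun t => zero_le)
    fun t => ofReal_abs_sub_le_tvDist (μ t) ν hA
  simpa [Real.dist_eq, Function.comp_def] using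
    (ENNReal.tendsto_toReal ENNReal.zero_ne_top).comp this

/-- Images of densities are at total variation distance at most the `L¹` distance. -/
theorem tvDist_le_eLpNorm {Ω E : Type*} [MeasurableSpace Ω] [MeasurableSpace E] {P : Measure Ω}
    {Φ : Ω → E} {w g : Ω → ℝ} (hw : Integrable w P) (hg : Integrable g P)
    {μ ν : Measure E} (hμ : ∀ A, MeasurableSet A → μ.real A = ∫ ω in Φ ⁻¹' A, w ω ∂P)
    (hν : ∀ A, MeasurableSet A → ν.real A = ∫ ω in Φ ⁻¹' A, g ω ∂P) :
    tvDist μ ν ≤ eLpNorm (w - g) 1 P := by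
  refine iSup₂_le fun A hA => ?_
  rw [hμ A hA, hν A hA, ← integral_sub hw.integrableOn hg.integrableOn, ← Real.norm_eq_abs,
    ofReal_norm, eLpNorm_one_eq_lintegral_enorm]
  exact (enorm_integral_le_lintegral_enorm _).trans (setLIntegral_le_lintegral _ _)

theorem map_withDensity_real {Ω E : Type*} [MeasurableSpace Ω] [MeasurableSpace E]
    {P : Measure Ω} {Φ : Ω → E} (hΦ : Measurable Φ) {g : Ω → ℝ} (hg : Integrable g P)
    (hg0 : ∀ ω, 0 ≤ g ω) {A : Set E} (hA : MeasurableSet A) :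
    ((P.withDensity fun ω => ENNReal.ofReal (g ω)).map Φ).real A = ∫ ω in Φ ⁻¹' A, g ω ∂P := by
  rw [Measure.real, Measure.map_apply hΦ hA, withDensity_apply _ (hΦ hA),
    integral_eq_lintegral_of_nonneg_ae (Eventually.of_forall hg0) hg.aestronglyMeasurable.restrict]

/-! ### Moving the particles along a path -/

/-- The law of an independent family restricted to a box depends only on the restricted marginal
laws. -/
theorem measure_inter_box_eq {Ω ι E : Type*} [MeasurableSpace Ω] [MeasurableSpace E]
    {P : Measure Ω} [IsProbabilityMeasure P] {U V : ι → Ω → E} (hU : iIndepFun U P)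
    (hV : iIndepFun V P) (hUm : ∀ i, Measurable (U i)) (hVm : ∀ i, Measurable (V i))
    (S : Finset ι) {B : ι → Set E} (hB : ∀ i, MeasurableSet (B i)) (hS : ∀ i ∉ S, B i = Set.univ)
    (h : ∀ i C, MeasurableSet C → P (U i ⁻¹' (C ∩ B i)) = P (V i ⁻¹' (C ∩ B i)))
    {D : Set (ι → E)} (hD : MeasurableSet D) :
    P ((fun ω i => U i ω) ⁻¹' D ∩ {ω | ∀ i, U i ω ∈ B i}) =
      P ((fun ω i => V i ω) ⁻¹' D ∩ {ω | ∀ i, V i ω ∈ B i}) := by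
  classical
  -- Because only indices in the finite set `S` are constrained, box and cylinder together form a
  -- finite intersection, and independence gives a finite product.
  have hbox : ∀ {W : ι → Ω → E}, iIndepFun W P → ∀ (F : Finset ι) (C : ι → Set E),
      (∀ i, MeasurableSet (C i)) →
      P ((fun ω i => W i ω) ⁻¹' {x | ∀ i ∈ F, x i ∈ C i} ∩ {ω | ∀ i, W i ω ∈ B i}) =
        ∏ i ∈ F ∪ S, P (W i ⁻¹' ((if i ∈ F then C i else Set.univ) ∩ B i)) := by
    intro W hW F C hC
    rw [← hW.measure_inter_preimage_eq_mul (F ∪ S)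
      (sets := fun i => (if i ∈ F then C i else Set.univ) ∩ B i) fun i _ =>
        (by split_ifs; exacts [hC i, MeasurableSet.univ] : MeasurableSet _).inter (hB i)]
    congr 1
    ext ω
    simp only [Set.mem_inter_iff, Set.mem_preimage, Set.mem_ofPred_eq, Set.mem_iInter,
      Finset.mem_union]
    constructor
    · rintro ⟨h1, h2⟩ i -
      refine ⟨?_, h2 i⟩
      split_ifs with hi
      exacts [h1 i hi, Set.mem_univ _]
    · intro h1
      refine ⟨fun i hi => ?_, fun i => ?_⟩
      · simpa [hi] using (h1 i (Or.inl hi)).1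
      · by_cases hi : i ∈ S
        · exact (h1 i (Or.inr hi)).2
        · rw [hS i hi]
          trivial
  have hUV : ∀ (F : Finset ι) (C : ι → Set E), (∀ i, MeasurableSet (C i)) →
      P ((fun ω i => U i ω) ⁻¹' {x | ∀ i ∈ F, x i ∈ C i} ∩ {ω | ∀ i, U i ω ∈ B i}) =
      P ((fun ω i => V i ω) ⁻¹' {x | ∀ i ∈ F, x i ∈ C i} ∩ {ω | ∀ i, V i ω ∈ B i}) := by
    intro F C hC
    rw [hbox hU F C hC, hbox hV F C hC]
    refine Finset.prod_congr rfl fun i _ => h i _ ?_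
    split_ifs
    exacts [hC i, MeasurableSet.univ]
  have hm : ∀ {W : ι → Ω → E}, (∀ i, Measurable (W i)) → Measurable fun ω i => W i ω :=
    fun hW => measurable_pi_iff.2 hW
  have happ : ∀ {W : ι → Ω → E}, (∀ i, Measurable (W i)) → ∀ D, MeasurableSet D →
      ((P.restrict {ω | ∀ i, W i ω ∈ B i}).map fun ω i => W i ω) D =
        P ((fun ω i => W i ω) ⁻¹' D ∩ {ω | ∀ i, W i ω ∈ B i}) := fun hW D hD => by
    rw [Measure.map_apply (hm hW) hD, Measure.restrict_apply (hm hW hD)]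
  rw [← happ hUm D hD, ← happ hVm D hD]
  congr 1
  refine ext_of_generate_finite (piiUnionInter (fun i : ι => {s | MeasurableSet[MeasurableSpace.comap
      (fun x : ι → E => x i) inferInstance] s}) Set.univ) ?_ (isPiSystem_piiUnionInter _
      (fun i => @MeasurableSpace.isPiSystem_measurableSet _ (_)) _) ?_ ?_
  · refine Eq.trans ?_ (generateFrom_piiUnionInter_measurableSet (fun i : ι =>
      MeasurableSpace.comap (fun x : ι → E => x i) inferInstance) Set.univ).symm
    simp only [Set.mem_univ, iSup_pos]
    rfl
  · rintro A ⟨F, -, f, hf, rfl⟩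
    have hC : ∀ i, ∃ C : Set E, MeasurableSet C ∧
        (i ∈ F → (fun x : ι → E => x i) ⁻¹' C = f i) := fun i => by
      by_cases hi : i ∈ F
      · obtain ⟨C, hC, hCf⟩ := hf i hi
        exact ⟨C, hC, fun _ => hCf⟩
      · exact ⟨Set.univ, MeasurableSet.univ, fun h => absurd h hi⟩
    choose C hC hCf using hC
    have hA : ⋂ i ∈ F, f i = {x | ∀ i ∈ F, x i ∈ C i} := by
      ext x
      simp only [Set.mem_iInter, Set.mem_ofPred_eq]
      exact forall₂_congr fun i hi => by rw [← hCf i hi]; rfl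
    have hAm : MeasurableSet (⋂ i ∈ F, f i) := Finset.measurableSet_biInter _ fun i hi => by
      rw [← hCf i hi]
      exact measurable_pi_apply i (hC i)
    rw [happ hUm _ hAm, happ hVm _ hAm, hA]
    exact hUV F C hC
  · rw [happ hUm _ MeasurableSet.univ, happ hVm _ MeasurableSet.univ]
    simpa using hUV ∅ (fun _ => Set.univ) fun _ => MeasurableSet.univ

/-! ### Comparison of the two lattices -/

/-- Moves every site of the path with steps `s` to the previous one. -/
noncomputable def pullBack {d t : ℕ} (s : Fin t → Fin d) (z : {z : Fin d → ℤ // z ≠ 0}) : Fin d → ℤ :=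
  open Classical in
  if h : ∃ k : Fin t, z.1 = toZ (pos s (k + 1)) then toZ (pos s h.choose) else z.1

theorem pullBack_pos {d t : ℕ} (s : Fin t → Fin d) {z : {z : Fin d → ℤ // z ≠ 0}} {k : Fin t}
    (hz : z.1 = toZ (pos s (k + 1))) : pullBack s z = toZ (pos s k) := by
  have h : ∃ k : Fin t, z.1 = toZ (pos s (k + 1)) := ⟨k, hz⟩
  have hc := pos_injective s (Nat.succ_le_of_lt h.choose.2) (Nat.succ_le_of_lt k.2)
    (toZ_injective (h.choose_spec.symm.trans hz))
  rw [pullBack, dif_pos h, Nat.succ_injective hc]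

theorem pullBack_of_not {d t : ℕ} (s : Fin t → Fin d) {z : {z : Fin d → ℤ // z ≠ 0}}
    (hz : ¬∃ k : Fin t, z.1 = toZ (pos s (k + 1))) : pullBack s z = z.1 :=
  dif_neg hz

theorem ne_pos_of_not {d t : ℕ} (s : Fin t → Fin d) {z : {z : Fin d → ℤ // z ≠ 0}}
    (hz : ¬∃ k : Fin t, z.1 = toZ (pos s (k + 1))) (k : Fin t) : z.1 ≠ toZ (pos s k) := by
  intro h
  obtain ⟨k, hk⟩ := k
  rcases k with _ | k
  · exact z.2 (by simpa [pos_zero, toZ_zero] using h)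
  · exact hz ⟨⟨k, by omega⟩, h⟩

theorem pullBack_injective {d t : ℕ} (s : Fin t → Fin d) : Function.Injective (pullBack s) := by
  intro z w hzw
  by_cases hz : ∃ k : Fin t, z.1 = toZ (pos s (k + 1)) <;>
    by_cases hw : ∃ k : Fin t, w.1 = toZ (pos s (k + 1))
  · obtain ⟨k, hk⟩ := hz
    obtain ⟨l, hl⟩ := hw
    rw [pullBack_pos s hk, pullBack_pos s hl] at hzw
    have := pos_injective s k.2.le l.2.le (toZ_injective hzw)
    exact Subtype.ext (by rw [hk, hl, this])
  · obtain ⟨k, hk⟩ := hz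
    rw [pullBack_pos s hk, pullBack_of_not s hw] at hzw
    exact absurd hzw.symm (ne_pos_of_not s hw k)
  · obtain ⟨l, hl⟩ := hw
    rw [pullBack_of_not s hz, pullBack_pos s hl] at hzw
    exact absurd hzw (ne_pos_of_not s hz l)
  · rw [pullBack_of_not s hz, pullBack_of_not s hw] at hzw
    exact Subtype.ext hzw

/-- The path is shifted back by one site, so its last site is the only label left unused. The
missing origin on the `Y` side is thereby transported to the end of the path. -/
theorem eq_last_of_notMem_range {d t : ℕ} (s : Fin t → Fin d) {z : Fin d → ℤ}
    (hz : z ∉ Set.range (pullBack s)) : z = toZ (pos s t) := by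
  have hlt : ∀ k : Fin t, z ≠ toZ (pos s k) := fun k hk => hz
    ⟨⟨toZ (pos s (k + 1)), toZ_ne_zero (pos_succ_ne_zero s k)⟩, by
      rw [hk, pullBack_pos s (k := k) rfl]⟩
  by_contra hne
  have h0 : z ≠ 0 := by
    rintro rfl
    rcases Nat.eq_zero_or_pos t with rfl | ht
    · exact hne (by simp [pos_zero, toZ_zero])
    · exact hlt ⟨0, ht⟩ (by simp [pos_zero, toZ_zero])
  refine hz ⟨⟨z, h0⟩, pullBack_of_not s ?_⟩
  rintro ⟨k, hk⟩
  rcases (Nat.succ_le_of_lt k.2).lt_or_eq with h | h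
  · exact hlt ⟨k + 1, h⟩ hk
  · exact hne (hk.trans (congrArg (fun n => toZ (pos s n)) h))

/-- The constraint on the position of the particle with label `z` when all bonds along the path
with steps `s` are open. -/
def pathBox {d t : ℕ} (L : ℝ) (s : Fin t → Fin d) (z : {z : Fin d → ℤ // z ≠ 0}) :
    Set (Fin d → ℝ) :=
  ⋂ (k : Fin t) (_ : z.1 = toZ (pos s (k + 1))),
    J L (toZ (pos s k)) ∩ J L (toZ (pos s (k + 1)))

theorem measurableSet_pathBox {d t : ℕ} (L : ℝ) (s : Fin t → Fin d)
    (z : {z : Fin d → ℤ // z ≠ 0}) : MeasurableSet (pathBox L s z) :=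
  MeasurableSet.iInter fun _ => MeasurableSet.iInter fun _ =>
    (measurableSet_J _ _).inter (measurableSet_J _ _)

/-- The event that the `X`-half of every bond along the path with steps `s` is open. -/
def outOpen {d t : ℕ} (L : ℝ) (s : Fin t → Fin d) : Set ((Fin d → ℤ) → Fin d → ℝ) :=
  {x | ∀ k : Fin t, x (toZ (pos s k)) ∈ slabOut L (s k)}

/-- The event that the `Y`-half of every bond along the path with steps `s` is open. -/
def inOpen {d t : ℕ} (L : ℝ) (s : Fin t → Fin d) :
    Set ({z : Fin d → ℤ // z ≠ 0} → Fin d → ℝ) :=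
  {y | ∀ k : Fin t, y ⟨toZ (pos s (k + 1)), toZ_ne_zero (pos_succ_ne_zero s k)⟩ ∈
    slabIn L (s k)}

theorem measurableSet_outOpen {d t : ℕ} (L : ℝ) (s : Fin t → Fin d) :
    MeasurableSet (outOpen L s) := by
  refine MeasurableSet.congr (MeasurableSet.iInter fun k : Fin t =>
    (measurable_pi_apply (toZ (pos s k)) :
      Measurable fun e : (Fin d → ℤ) → Fin d → ℝ => e _) (measurableSet_slabOut L (s k))) ?_
  ext e
  simp [outOpen]

theorem measurableSet_inOpen {d t : ℕ} (L : ℝ) (s : Fin t → Fin d) :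
    MeasurableSet (inOpen L s) := by
  refine MeasurableSet.congr (MeasurableSet.iInter fun k : Fin t =>
    (measurable_pi_apply ⟨toZ (pos s (k + 1)), toZ_ne_zero (pos_succ_ne_zero s k)⟩ :
      Measurable fun e : {z : Fin d → ℤ // z ≠ 0} → Fin d → ℝ => e _)
      (measurableSet_slabIn L (s k))) ?_
  ext e
  simp [inOpen]

theorem setOf_envOpen {d t : ℕ} {Ω : Type*} (L : ℝ) (X : (Fin d → ℤ) → Ω → Fin d → ℝ)
    (Y : {z : Fin d → ℤ // z ≠ 0} → Ω → Fin d → ℝ) (s : Fin t → Fin d) :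
    {ω | EnvOpen L s fun i => envOf X Y i ω} =
      (fun ω z => X z ω) ⁻¹' outOpen L s ∩ (fun ω z => Y z ω) ⁻¹' inOpen L s := by
  ext ω
  simp [EnvOpen, outOpen, inOpen, envOf, forall_and]

section Model

variable {d : ℕ} {Ω : Type*} [MeasurableSpace Ω] {P : Measure Ω} {L : ℝ}
  {X : (Fin d → ℤ) → Ω → Fin d → ℝ} {Y : {z : Fin d → ℤ // z ≠ 0} → Ω → Fin d → ℝ}

/-- All cubes `J L z` have the same volume, so inside an intersection of two cubes the unnormalized
laws of the two particles agree. -/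
theorem measure_pt_add (hL : 1 / 2 < L) {U : Ω → Fin d → ℝ}
    (hU : pdf.IsUniform U (Set.Icc (fun _ => -L) (fun _ => L)) P volume) (z : Fin d → ℤ)
    {D : Set (Fin d → ℝ)} (hD : MeasurableSet D) :
    P ((fun ω => pt z + U ω) ⁻¹' D) =
      volume (J L z ∩ D) / volume (Set.Icc (fun _ : Fin d => -L) (fun _ => L)) := by
  have h : (fun ω => pt z + U ω) ⁻¹' D = U ⁻¹' ((pt z + ·) ⁻¹' D) := rfl
  rw [h, hU.measure_preimage (volume_box_ne_zero hL) (volume_box_ne_top L)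
    (measurable_const_add _ hD), ← measure_preimage_add volume (pt z) (J L z ∩ D),
    Set.preimage_inter]
  congr 3
  ext x
  rw [Set.mem_preimage, pt_add_mem_J, sub_self, J_zero]

theorem IsModel.indepFun (h : IsModel P L X Y) :
    IndepFun (fun ω z => X z ω) (fun ω z => Y z ω) P := by
  have hle : ∀ i, MeasurableSpace.comap (Sum.elim X Y i) inferInstance ≤
      ‹MeasurableSpace Ω› := by
    rintro (z | z)
    · exact (h.measurable_X z).comap_le
    · exact (h.measurable_Y z).comap_le
  have := indep_iSup_of_disjoint hle h.indep.iIndep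
    (S := Set.range Sum.inl) (T := Set.range Sum.inr)
    Set.isCompl_range_inl_range_inr.disjoint
  rw [IndepFun_iff_Indep]
  refine indep_of_indep_of_le_right (indep_of_indep_of_le_left this ?_) ?_
  · refine measurable_iff_comap_le.1 (@measurable_pi_lambda _ _ _ (_) _ _ fun z => ?_)
    exact (comap_measurable (X z)).mono
      (le_iSup₂_of_le (f := fun i _ => MeasurableSpace.comap (Sum.elim X Y i) inferInstance)
        (Sum.inl z) ⟨z, rfl⟩ le_rfl) le_rfl
  · refine measurable_iff_comap_le.1 (@measurable_pi_lambda _ _ _ (_) _ _ fun z => ?_)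
    exact (comap_measurable (Y z)).mono
      (le_iSup₂_of_le (f := fun i _ => MeasurableSpace.comap (Sum.elim X Y i) inferInstance)
        (Sum.inr z) ⟨z, rfl⟩ le_rfl) le_rfl

/-- Given that the bonds along a path are open, local observations far from the end of the path
do not distinguish the lattices with and without the origin. -/
theorem IsModel.measure_isLocal [IsProbabilityMeasure P] (h : IsModel P L X Y) {t : ℕ}
    (s : Fin t → Fin d) {A : Set (Conf d)} {K : Set (Fin d → ℝ)} (hA : MeasurableSet A)
    (hloc : IsLocal A K) (hK : Disjoint (J L (toZ (pos s t))) K) :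
    P ((fun ω => proj (latticeX X ω)) ⁻¹' A ∩ {ω | EnvOpen L s fun i => envOf X Y i ω}) =
      P ((fun ω => proj (latticeY Y ω)) ⁻¹' A ∩ {ω | EnvOpen L s fun i => envOf X Y i ω}) := by
  have hD1 : MeasurableSet {x : (Fin d → ℤ) → Fin d → ℝ | proj (fun z => pt z + x z) ∈ A} :=
    (measurable_proj.comp (measurable_pi_iff.2 fun z =>
      (measurable_pi_apply z).const_add _)) hA
  have hD2 : MeasurableSet
      {y : {z : Fin d → ℤ // z ≠ 0} → Fin d → ℝ | proj (fun z => pt z.1 + y z) ∈ A} :=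
    (measurable_proj.comp (measurable_pi_iff.2 fun z =>
      (measurable_pi_apply z).const_add _)) hA
  -- The configuration event involves `X` only, so the `Y` half of the open bonds splits off with a
  -- probability independent of the path. The roles are exchanged in `hY`, with the same factor.
  have hX : P ((fun ω => proj (latticeX X ω)) ⁻¹' A ∩ {ω | EnvOpen L s fun i => envOf X Y i ω}) =
      P ((fun ω => proj (latticeX X ω)) ⁻¹' A ∩ (fun ω z => X z ω) ⁻¹' outOpen L s) *
        slabProb L ^ t := by
    have := h.indepFun.measure_inter_preimage_eq_mul _ _
      (hD1.inter (measurableSet_outOpen L s)) (measurableSet_inOpen L s)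
    rw [setOf_envOpen, ← Set.inter_assoc, ← h.isEnv.measure_in s]
    exact this
  have hY : P ((fun ω => proj (latticeY Y ω)) ⁻¹' A ∩ {ω | EnvOpen L s fun i => envOf X Y i ω}) =
      P ((fun ω => proj (latticeY Y ω)) ⁻¹' A ∩ (fun ω z => Y z ω) ⁻¹' inOpen L s) *
        slabProb L ^ t := by
    have := h.indepFun.measure_inter_preimage_eq_mul _ _
      (measurableSet_outOpen L s) (hD2.inter (measurableSet_inOpen L s))
    rw [setOf_envOpen, Set.inter_left_comm, ← h.isEnv.measure_out s, mul_comm]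
    exact this
  rw [hX, hY]
  congr 1
  have hfin : (Set.range (pullBack s))ᶜ.Finite :=
    (Set.finite_singleton (toZ (pos s t))).subset fun z hz => eq_last_of_notMem_range s hz
  -- Relabelling by `pullBack s` loses only the particle of the last site, which almost surely lies
  -- in its cube, hence outside `K`; the local event `A` does not see it.
  have hpull : (fun ω => proj (latticeX X ω)) ⁻¹' A =ᵐ[P]
      (fun ω => proj fun z => latticeX X ω (pullBack s z)) ⁻¹' A := by
    rw [eventuallyEq_set]
    filter_upwards [h.ae_latticeX] with ω hω
    refine hloc _ _ fun K' hK' hm => (proj_comp_apply (latticeX X ω) (pullBack_injective s) hfin hm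
      fun z hz hzK => ?_).symm
    rw [eq_last_of_notMem_range s hz] at hzK
    exact Set.disjoint_left.1 hK (hω _) (hK' hzK)
  have hout : (fun ω z => X z ω) ⁻¹' outOpen L s =
      {ω | ∀ z, latticeX X ω (pullBack s z) ∈ pathBox L s z} := by
    ext ω
    simp only [Set.mem_preimage, outOpen, pathBox, Set.mem_iInter, Set.mem_ofPred_eq]
    constructor
    · intro hω z k hz
      rw [pullBack_pos s hz, toZ_pos_succ]
      exact (pt_add_mem_slabOut L _ _ _).2 (hω k)
    · intro hω k
      have := hω ⟨toZ (pos s (k + 1)), toZ_ne_zero (pos_succ_ne_zero s k)⟩ k rfl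
      rw [pullBack_pos s (k := k) rfl, toZ_pos_succ] at this
      exact (pt_add_mem_slabOut L _ _ _).1 this
  have hin : (fun ω z => Y z ω) ⁻¹' inOpen L s = {ω | ∀ z, latticeY Y ω z ∈ pathBox L s z} := by
    ext ω
    simp only [Set.mem_preimage, inOpen, pathBox, Set.mem_iInter, Set.mem_ofPred_eq]
    constructor
    · rintro hω ⟨z, hz0⟩ k rfl
      have := (pt_add_mem_slabIn L (toZ (pos s k)) _ _).2 (hω k)
      rw [← toZ_pos_succ] at this
      exact this
    · intro hω k
      have := hω ⟨toZ (pos s (k + 1)), toZ_ne_zero (pos_succ_ne_zero s k)⟩ k rfl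
      refine (pt_add_mem_slabIn L (toZ (pos s k)) _ _).1 ?_
      rw [← toZ_pos_succ]
      exact this
  refine (measure_congr (hpull.inter (EventuallyEq.refl _ _))).trans ?_
  rw [hout, hin]
  have hindX : iIndepFun (fun z ω => latticeX X ω (pullBack s z)) P :=
    ((h.indep.precomp Sum.inl_injective).comp (fun z x => pt z + x)
      fun z => measurable_const_add _).precomp (pullBack_injective s)
  have hindY : iIndepFun (fun z ω => latticeY Y ω z) P :=
    (h.indep.precomp Sum.inr_injective).comp (fun z x => pt z.1 + x)
      fun z => measurable_const_add _
  classical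
  refine measure_inter_box_eq hindX hindY
    (fun z => (measurable_pi_apply _).comp h.measurable_latticeX)
    (fun z => (measurable_pi_apply _).comp h.measurable_latticeY)
    (Finset.univ.image fun k : Fin t =>
      ⟨toZ (pos s (k + 1)), toZ_ne_zero (pos_succ_ne_zero s k)⟩)
    (measurableSet_pathBox L s) (fun z hz => ?_) (fun z C hC => ?_) (measurable_proj hA)
  · simp only [Finset.mem_image, Finset.mem_univ, true_and, not_exists] at hz
    simp only [pathBox, Set.iInter_eq_univ]
    exact fun k hk => absurd (Subtype.ext hk.symm) (hz k)
  -- On the path the constraint lies in the cubes of both `z_k` and `z_{k+1}`, so intersecting with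
  -- either cube changes nothing. Off the path the two labels, and hence the two cubes, coincide.
  · have hm := hC.inter (measurableSet_pathBox L s z)
    refine (measure_pt_add h.half_lt (h.uniform_X (pullBack s z)) _ hm).trans
      (Eq.trans ?_ (measure_pt_add h.half_lt (h.uniform_Y z) _ hm).symm)
    by_cases hz : ∃ k : Fin t, z.1 = toZ (pos s (k + 1))
    · obtain ⟨k, hk⟩ := hz
      have hsub : pathBox L s z ⊆ J L (toZ (pos s k)) ∩ J L (toZ (pos s (k + 1))) :=
        Set.iInter₂_subset k hk
      rw [pullBack_pos s hk, hk,
        Set.inter_eq_self_of_subset_right (Set.inter_subset_right.trans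
          (hsub.trans Set.inter_subset_left)),
        Set.inter_eq_self_of_subset_right (Set.inter_subset_right.trans
          (hsub.trans Set.inter_subset_right))]
    · rw [pullBack_of_not s hz]

/-- Cubes of far away levels do not meet a given compact set. -/
theorem exists_disjoint_J (L : ℝ) {K : Set (Fin d → ℝ)} (hK : IsCompact K) :
    ∃ T : ℕ, ∀ t ≥ T, ∀ s : Fin t → Fin d, Disjoint (J L (toZ (pos s t))) K := by
  have hc : Continuous fun x : Fin d → ℝ => ∑ i, x i := by fun_prop
  obtain ⟨C, hC⟩ := (hK.image hc).bddAbove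
  obtain ⟨T, hT⟩ := exists_nat_gt (C + d * L)
  refine ⟨T, fun t ht s => Set.disjoint_left.2 fun x hx hxK => ?_⟩
  -- The coordinate sum is at least `t - d * L` on the cube and at most `C` on `K`, whence the
  -- choice of `T`.
  have h1 : ∑ i, x i ≤ C := hC ⟨x, hxK, rfl⟩
  have h2 : ∑ i, ((toZ (pos s t) i : ℝ) - L) ≤ ∑ i, x i :=
    Finset.sum_le_sum fun i _ => hx.1 i
  have h3 : ∑ i, (toZ (pos s t) i : ℝ) = t := by
    simp only [toZ, Int.cast_natCast]
    exact_mod_cast sum_pos s le_rfl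
  rw [Finset.sum_sub_distrib, h3] at h2
  have h4 : (T : ℝ) ≤ t := by exact_mod_cast ht
  simp at h2
  linarith

theorem IsModel.mu_eq_muZero [IsProbabilityMeasure P] (h : IsModel P L X Y) {A : Set (Conf d)}
    {K : Set (Fin d → ℝ)} (hA : MeasurableSet A) (hK : IsCompact K) (hloc : IsLocal A K) :
    ∀ᶠ t in atTop, mu P L X Y t A = muZero P L X Y t A := by
  obtain ⟨T, hT⟩ := exists_disjoint_J L hK
  filter_upwards [eventually_ge_atTop T] with t ht
  rw [h.mu_apply t hA, h.muZero_apply t hA]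
  congr 1
  exact Finset.sum_congr rfl fun s _ => h.measure_isLocal s hA hloc (hT t ht s)

end Model

/-! ### Existence and identification of the limits -/

section Limit

variable {d : ℕ} {Ω : Type*} [MeasurableSpace Ω] {P : Measure Ω} {L : ℝ}
  {X : (Fin d → ℤ) → Ω → Fin d → ℝ} {Y : {z : Fin d → ℤ // z ≠ 0} → Ω → Fin d → ℝ}

theorem real_eq_setIntegral {t : ℕ} (hm : Measurable fun ω i => envOf X Y i ω) {ν : Measure (Conf d)}
    {A : Set (Conf d)} {B : Set Ω} (hν : ν A = norming d L t * ∑ s : Fin t → Fin d,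
      P (B ∩ {ω | EnvOpen L s fun i => envOf X Y i ω})) :
    ν.real A = ∫ ω in B, (weight L t fun i => envOf X Y i ω).toReal ∂P := by
  have hwm : Measurable fun ω => weight L t fun i => envOf X Y i ω :=
    (measurable_weight L t).comp hm
  rw [Measure.real, hν, ← setLIntegral_weight L hm,
    integral_toReal hwm.aemeasurable (Eventually.of_forall fun ω => (weight_ne_top L t _).lt_top)]

/-- If the normalized numbers of open paths do not vanish in the limit, both sequences of
restricted measures converge in total variation, to the same measure. -/
theorem IsModel.exists_limit [IsProbabilityMeasure P] (hd : d ≠ 0) (h : IsModel P L X Y)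
    (h0 : ∫⁻ ω, limWeight L (fun i => envOf X Y i ω) ∂P ≠ 0) :
    ∃ μ : Measure (Conf d), IsFiniteMeasure μ ∧
      Tendsto (fun t => tvDist (mu P L X Y t) μ) atTop (𝓝 0) ∧
      Tendsto (fun t => tvDist (muZero P L X Y t) μ) atTop (𝓝 0) := by
  obtain ⟨g, hg, hg0, hlim⟩ := h.isEnv.exists_tendsto_eLpNorm hd h0
  have hm := h.isEnv.measurable_env
  have hw := h.isEnv.integrable_weight hd
  have hX : Measurable fun ω => proj (latticeX X ω) := measurable_proj.comp h.measurable_latticeX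
  have hY : Measurable fun ω => proj (latticeY Y ω) := measurable_proj.comp h.measurable_latticeY
  have hfin : IsFiniteMeasure (P.withDensity fun ω => ENNReal.ofReal (g ω)) :=
    isFiniteMeasure_withDensity_ofReal hg.2
  -- The same limiting density `g` serves both lattices; only the map to configurations differs.
  set μ := (P.withDensity fun ω => ENNReal.ofReal (g ω)).map fun ω => proj (latticeX X ω) with hμ
  set ν := (P.withDensity fun ω => ENNReal.ofReal (g ω)).map fun ω => proj (latticeY Y ω) with hν
  have hμlim : Tendsto (fun t => tvDist (mu P L X Y t) μ) atTop (𝓝 0) :=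
    tendsto_of_tendsto_of_tendsto_of_le_of_le tendsto_const_nhds hlim (fun t => zero_le)
      fun t => tvDist_le_eLpNorm (hw t) hg
        (fun A hA => real_eq_setIntegral hm (h.mu_apply t hA))
        fun A hA => map_withDensity_real hX hg hg0 hA
  have hνlim : Tendsto (fun t => tvDist (muZero P L X Y t) ν) atTop (𝓝 0) :=
    tendsto_of_tendsto_of_tendsto_of_le_of_le tendsto_const_nhds hlim (fun t => zero_le)
      fun t => tvDist_le_eLpNorm (hw t) hg
        (fun A hA => real_eq_setIntegral hm (h.muZero_apply t hA))
        fun A hA => map_withDensity_real hY hg hg0 hA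
  have hμf : IsFiniteMeasure μ := inferInstance
  have hνf : IsFiniteMeasure ν := inferInstance
  have heq : μ = ν := by
    -- For fixed local `A` the two sequences agree from some time on, so their limits do; no
    -- uniformity in `A` is needed.
    refine measure_ext_of_isLocal fun A K hA hK hloc => ?_
    rw [← measureReal_eq_measureReal_iff]
    refine tendsto_nhds_unique_of_eventuallyEq (tendsto_real_of_tvDist hμlim hA)
      (tendsto_real_of_tvDist hνlim hA) ?_
    filter_upwards [h.mu_eq_muZero hA hK hloc] with t ht
    rw [Measure.real, Measure.real, ht]
  exact ⟨μ, hμf, hμlim, heq ▸ hνlim⟩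

end Limit

/-- Where the normalized counts converge, `limWeight` is the limit, which is positive. If the
integral vanished, this set would be contained in a null set. -/
theorem lintegral_limWeight_ne_zero {m : ℕ} {Ω : Type*} [MeasurableSpace Ω] {P : Measure Ω}
    {L : ℝ} {X : (Fin (m + 1) → ℤ) → Ω → Fin (m + 1) → ℝ}
    {Y : {z : Fin (m + 1) → ℤ // z ≠ 0} → Ω → Fin (m + 1) → ℝ}
    (hm : Measurable fun ω i => envOf X Y i ω)
    (hperc : 0 < P {ω | ∃ c : ℝ, 0 < c ∧
      Tendsto (fun t : ℕ => numPathsBar L X Y t ω) atTop (𝓝 c)}) :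
    ∫⁻ ω, limWeight L (fun i => envOf X Y i ω) ∂P ≠ 0 := by
  intro h0
  have hlm : Measurable fun ω => limWeight L fun i => envOf X Y i ω :=
    (measurable_limWeight L).comp hm
  rw [lintegral_eq_zero_iff hlm] at h0
  refine hperc.ne' (measure_mono_null ?_ (ae_iff.1 h0))
  rintro ω ⟨c, hc, hlim⟩
  simp only [numPathsBar_eq] at hlim
  have h := ENNReal.tendsto_ofReal hlim
  simp only [ENNReal.ofReal_toReal (weight_ne_top L _ _)] at h
  have h1 : limWeight L (fun i => envOf X Y i ω) = ENNReal.ofReal c := h.liminf_eq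
  simpa [h1] using hc

end PerturbedLattice

theorem proposition2p6 (m : ℕ) (hd : 4 ≤ m + 1)
    {Ω : Type*} [MeasurableSpace Ω] (P : Measure Ω) [IsProbabilityMeasure P]
    (L : ℝ) (hL : 1 / 2 < L)
    (X : (Fin (m + 1) → ℤ) → Ω → Fin (m + 1) → ℝ)
    (Y : {z : Fin (m + 1) → ℤ // z ≠ 0} → Ω → Fin (m + 1) → ℝ)
    (hXmeas : ∀ z, Measurable (X z)) (hYmeas : ∀ z, Measurable (Y z))
    (hXunif : ∀ z, pdf.IsUniform (X z) (Set.Icc (fun _ => -L) (fun _ => L)) P volume)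
    (hYunif : ∀ z, pdf.IsUniform (Y z) (Set.Icc (fun _ => -L) (fun _ => L)) P volume)
    (hindep : iIndepFun (Sum.elim X Y) P)
    (hperc : 0 < P {ω | ∃ c : ℝ, 0 < c ∧
      Tendsto (fun t : ℕ => PerturbedLattice.numPathsBar L X Y t ω) atTop (𝓝 c)}) :
    ∃ μrest μrestZero : Measure (PerturbedLattice.Conf (m + 1)),
      IsFiniteMeasure μrest ∧ IsFiniteMeasure μrestZero ∧
      Tendsto (fun t : ℕ => PerturbedLattice.tvDist (PerturbedLattice.mu P L X Y t) μrest)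
        atTop (𝓝 0) ∧
      Tendsto (fun t : ℕ => PerturbedLattice.tvDist (PerturbedLattice.muZero P L X Y t) μrestZero)
        atTop (𝓝 0) ∧
      μrest ≪ μrestZero ∧ μrestZero ≪ μrest := by
  have h : PerturbedLattice.IsModel P L X Y := ⟨hL, hXmeas, hYmeas, hXunif, hYunif, hindep⟩
  obtain ⟨μ, hμ, h1, h2⟩ := h.exists_limit m.succ_ne_zero
    (PerturbedLattice.lintegral_limWeight_ne_zero h.isEnv.measurable_env hperc)
  -- Both sequences have the same limit, so mutual absolute continuity is reflexivity.
  exact ⟨μ, μ, hμ, hμ, h1, h2, Measure.AbsolutelyContinuous.refl μ,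
    Measure.AbsolutelyContinuous.refl μ⟩
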